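/- Let $\mathbb S^2$ be the unit sphere in $\mathbb R^3$. An arc $a$ of a great circle is said to feed into an arc $b$ if an endpoint of $a$ lies in the relative interior of $b$. A spherical occlusion diagram (SOD) is a finite non-empty set $\mathcal S$ of (nondegenerate) arcs of great circles on $\mathbb S^2$ such that: (A1') each arc of $\mathcal S$ is shorter than a great semicircle, and any two distinct arcs of $\mathcal S$ have disjoint relative interiors; (A2) each arc of $\mathcal S$ feeds into two arcs of $\mathcal S$; (A3) all arcs of $\mathcal S$ that feed into the same arc reach it from the same side. A swirl of $\mathcal S$ is a cycle of distinct arcs of $\mathcal S$ (considered up to rotation) such that each arc feeds into the next, going always clockwise or always counterclockwise; that is, when one follows each arc to the endpoint at which it feeds into the next arc and then proceeds along that next arc, one turns right every time or turns left every time. Theorem. Every spherical occlusion diagram has at least four swirls. The bound is tight: there exists a spherical occlusion diagram with exactly four swirls. -/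

import Mathlib

noncomputable section

namespace SOD

/-- Euclidean three-space; the sphere in question is its unit sphere. -/
abbrev E3 : Type := EuclideanSpace ℝ (Fin 3)

/-- A (proper, nondegenerate) arc of a great circle on the unit sphere, given by one of its two
arc-length parametrizations: it starts at the unit vector `origin` in the unit tangent direction
`dir` and has length `len`. The choice of the parametrization is immaterial: all the notions below
treat the two endpoints symmetrically. -/
structure GreatArc where
  origin : E3
  dir : E3
  len : ℝ
  norm_origin : ‖origin‖ = 1
  norm_dir : ‖dir‖ = 1
  inner_origin_dir : inner ℝ origin dir = 0
  len_pos : 0 < len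
  len_lt : len < 2 * Real.pi

namespace GreatArc

/-- The point at (signed) arc length `t` from `origin` on the great circle of the arc. -/
def point (a : GreatArc) (t : ℝ) : E3 := Real.cos t • a.origin + Real.sin t • a.dir

/-- The relative interior of an arc: the arc without its two endpoints. -/
def relInterior (a : GreatArc) : Set E3 := a.point '' Set.Ioo 0 a.len

/-- The endpoint that is reached when the arc is traversed forward (`true`, away from `origin`)
or backward (`false`, towards `origin`). -/
def head (a : GreatArc) (d : Bool) : E3 := if d then a.point a.len else a.point 0

/-- `a` feeds into `b`: an endpoint of `a` is in the relative interior of `b`. -/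
def FeedsInto (a b : GreatArc) : Prop := ∃ d : Bool, a.head d ∈ b.relInterior

/-- The scalar triple product `⟪origin × dir, x⟫`. On the sphere seen from outside, it is positive
exactly for the points `x` strictly to the left of the great circle of `a` directed forward. -/
def side (a : GreatArc) (x : E3) : ℝ :=
  Matrix.det ![a.origin.ofLp, a.dir.ofLp, x.ofLp]

/-- The open half-space whose trace on the sphere is the open hemisphere to the left of an arc
that is traversed forward (`true`) or backward (`false`). -/
def leftOf (a : GreatArc) (d : Bool) : Set E3 :=
  if d then {x | 0 < a.side x} else {x | a.side x < 0}

/-- The same for the right: it is the left of the reverse traversal. -/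
def rightOf (a : GreatArc) (d : Bool) : Set E3 := a.leftOf (!d)

end GreatArc

open GreatArc

/-- Spherical occlusion diagrams. Distinct members of `S` are distinct arcs as point sets, because
their (nonempty) relative interiors are disjoint. -/
structure IsSOD (S : Finset GreatArc) : Prop where
  nonempty : S.Nonempty
  /-- Each arc is shorter than a great semicircle. -/
  short : ∀ a ∈ S, a.len < Real.pi
  /-- Any two arcs are internally disjoint. -/
  disjoint : ∀ a ∈ S, ∀ b ∈ S, a ≠ b → Disjoint a.relInterior b.relInterior
  /-- Each arc feeds into two arcs. -/
  feeds_two : ∀ a ∈ S, {b | b ∈ S ∧ FeedsInto a b}.encard = 2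
  /-- All arcs that feed into the same arc `b` reach it from the same side. (An arc that is shorter
  than a semicircle, feeds into `b` and is internally disjoint from `b` lies, apart from one
  endpoint, entirely on one side of the great circle of `b`.) -/
  same_side : ∀ b ∈ S, ∃ d : Bool, ∀ a ∈ S, FeedsInto a b → a.relInterior ⊆ b.leftOf d

/-- When every arc `x` is traversed in the direction `d x`, the arc `a` ends in the relative
interior of `b`, and the passage from `a` to `b` is a right turn: after it, the side that `a`
came from is on the right. -/
def RightTurn (d : GreatArc → Bool) (a b : GreatArc) : Prop :=
  a.head (d a) ∈ b.relInterior ∧ a.relInterior ⊆ b.rightOf (d b)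

/-- The same with a left turn. -/
def LeftTurn (d : GreatArc → Bool) (a b : GreatArc) : Prop :=
  a.head (d a) ∈ b.relInterior ∧ a.relInterior ⊆ b.leftOf (d b)

/-- A swirl of `S`: a cycle of distinct arcs of `S` (up to rotation) such that each arc feeds into
the next one, going always clockwise (the traversal always turns right) or always counterclockwise
(it always turns left). -/
def IsSwirl (S : Finset GreatArc) (c : Cycle GreatArc) : Prop :=
  c ≠ Cycle.nil ∧ c.Nodup ∧ (∀ a ∈ c, a ∈ S) ∧
    ∃ d : GreatArc → Bool, c.Chain (RightTurn d) ∨ c.Chain (LeftTurn d)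

/-- The set of swirls of `S`. -/
def swirls (S : Finset GreatArc) : Set (Cycle GreatArc) := {c | IsSwirl S c}

end SOD

end

noncomputable section

open Real Set Filter Topology

namespace SOD

open GreatArc

/-! Fix a sense `e` of turning. All arcs that feed into an arc come from one side, so turning always
in the sense `e` is a function `Wiring.walk` on the finite set of arcs, and the swirls of sense `e`
are the cycles of this function (`Wiring.chain_next`, `Wiring.isSwirlOf_orbit`). Walks of the two
senses leave an arc at opposite ends, so no swirl has both senses, and it is enough to find two
cycles for each sense. For this it suffices that every arc is avoided by some cycle
(`Wiring.exists_periodic_avoiding`): a cycle that avoids an arc of a first cycle is a second one.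

To avoid `c`, observe the sphere from a direction `x` off all great circles and very close to a
point `p` of `c` that the walk passes after every arrival on `c`. On each arc take the direction
that goes around `x`, counterclockwise if the walk turns right. The cycles of the resulting map
`Wiring.spin` surround `x`, and the part of the sphere that they hide from `x`, the closed set
`Wiring.region`, is a trap for the walk (`Wiring.along_mem_region`). Only the border facing `x`
matters. There the walk either follows the border, or runs backwards along it and slips behind the
preceding arc of the cycle, because arrivals come from the side of `x`. But `p` is outside the
region (`Wiring.exists_observer`), so a walk that starts inside never gets onto `c`: it would then
have to pass `p`.

For tightness, eight explicit arcs with integer endpoint directions form a diagram in which each of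
the two walks has just two cycles, all of length three. -/

/-! ### Determinants and parametrized arcs -/

/-- The determinant of three vectors of `E3`. -/
def det3 (x y z : E3) : ℝ := Matrix.det ![x.ofLp, y.ofLp, z.ofLp]

lemma det3_apply (x y z : E3) : det3 x y z =
    x 0 * y 1 * z 2 - x 0 * y 2 * z 1 - x 1 * y 0 * z 2 + x 1 * y 2 * z 0 + x 2 * y 0 * z 1
      - x 2 * y 1 * z 0 := by
  rw [det3]
  exact (Matrix.det_fin_three _).trans rfl

lemma det3_add (x y z w : E3) : det3 x y (z + w) = det3 x y z + det3 x y w := by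
  simp only [det3_apply, PiLp.add_apply]; ring

lemma det3_smul (x y z : E3) (c : ℝ) : det3 x y (c • z) = c * det3 x y z := by
  simp only [det3_apply, PiLp.smul_apply, smul_eq_mul]; ring

lemma det3_rotate (x y z : E3) : det3 x y z = det3 y z x := by
  simp only [det3_apply]; ring

lemma det3_swap (x y z : E3) : det3 x z y = -det3 x y z := by
  simp only [det3_apply]; ring

lemma det3_self_right (x y : E3) : det3 x y y = 0 := by
  simp only [det3_apply]; ring

lemma det3_self_outer (x y : E3) : det3 x y x = 0 := by
  simp only [det3_apply]; ring

lemma continuous_det3 (x y : E3) : Continuous (det3 x y) := by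
  have : det3 x y = fun z => x 0 * y 1 * z 2 - x 0 * y 2 * z 1 - x 1 * y 0 * z 2
      + x 1 * y 2 * z 0 + x 2 * y 0 * z 1 - x 2 * y 1 * z 0 := funext (det3_apply x y)
  rw [this]; fun_prop

lemma continuous_det3_mid (x y : E3) : Continuous fun z => det3 x z y := by
  have : (fun z => det3 x z y) = fun z => -det3 x y z := funext fun z => det3_swap x y z
  rw [this]; exact (continuous_det3 x y).neg

/-- Cramer's rule. -/
lemma det3_cramer (x u v p : E3) :
    det3 x u v • p = det3 u v p • x + det3 x p v • u + det3 x u p • v := by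
  ext i
  fin_cases i <;> simp [det3_apply] <;> ring

namespace GreatArc

lemma side_eq (a : GreatArc) (x : E3) : a.side x = det3 a.origin a.dir x := rfl

/-- The point at arc length `s` of the traversal of `a` in direction `d`. -/
def along (a : GreatArc) (d : Bool) (s : ℝ) : E3 := a.point (if d then s else a.len - s)

/-- The signed side of `x`, positive to the left of the traversal in direction `d`. -/
def lside (a : GreatArc) (d : Bool) (x : E3) : ℝ := if d then a.side x else -a.side x

lemma mem_leftOf {a : GreatArc} {d : Bool} {x : E3} : x ∈ a.leftOf d ↔ 0 < a.lside d x := by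
  cases d <;> simp [leftOf, lside]

lemma lside_not (a : GreatArc) (d : Bool) (x : E3) : a.lside (!d) x = -a.lside d x := by
  cases d <;> simp [lside]

lemma head_eq (a : GreatArc) (d : Bool) : a.head d = a.along d a.len := by
  cases d <;> simp [head, along]

lemma along_not (a : GreatArc) (d : Bool) (s : ℝ) : a.along (!d) s = a.along d (a.len - s) := by
  cases d <;> simp [along]

lemma continuous_along (a : GreatArc) (d : Bool) : Continuous (a.along d) := by
  have h : Continuous a.point := by unfold point; fun_prop
  cases d
  · exact h.comp (by fun_prop : Continuous fun s : ℝ => a.len - s)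
  · exact h

lemma side_point (a : GreatArc) (t : ℝ) : a.side (a.point t) = 0 := by
  rw [side_eq, point, det3_add, det3_smul, det3_smul, det3_self_right, det3_self_outer]; ring

lemma lside_along (a : GreatArc) (d d' : Bool) (s : ℝ) : a.lside d (a.along d' s) = 0 := by
  cases d <;> simp [lside, along, side_point]

lemma det3_point (a : GreatArc) (s t : ℝ) (x : E3) :
    det3 (a.point s) (a.point t) x = sin (t - s) * a.side x := by
  rw [side_eq, sin_sub]
  simp only [det3_apply, point, PiLp.add_apply, PiLp.smul_apply, smul_eq_mul]; ring

/-- This reduces the sign of a determinant with two points of one arc to the side of the third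
vector: the sine is positive if `0 < t - s < π`. -/
lemma det3_along (a : GreatArc) (d : Bool) (s t : ℝ) (x : E3) :
    det3 (a.along d s) (a.along d t) x = sin (t - s) * a.lside d x := by
  cases d
  · simp only [along, lside, det3_point, Bool.false_eq_true, if_false]
    rw [show a.len - t - (a.len - s) = -(t - s) by ring, sin_neg]; ring
  · simp [along, lside, det3_point]

lemma relInterior_eq (a : GreatArc) (d : Bool) : a.relInterior = a.along d '' Ioo 0 a.len := by
  cases d
  · ext p
    constructor
    · rintro ⟨t, ⟨h0, h1⟩, rfl⟩
      exact ⟨a.len - t, ⟨by linarith, by linarith⟩, by simp [along]⟩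
    · rintro ⟨t, ⟨h0, h1⟩, rfl⟩
      exact ⟨a.len - t, ⟨by linarith, by linarith⟩, by simp [along]⟩
  · rfl

lemma relInterior_nonempty (a : GreatArc) : a.relInterior.Nonempty :=
  ⟨a.point (a.len / 2), a.len / 2, ⟨by linarith [a.len_pos], by linarith [a.len_pos]⟩, rfl⟩

lemma inner_point (a : GreatArc) (s t : ℝ) : inner ℝ (a.point s) (a.point t) = cos (t - s) := by
  have h : inner ℝ a.dir a.origin = (0 : ℝ) := by rw [real_inner_comm, a.inner_origin_dir]
  simp only [point, inner_add_left, inner_add_right, inner_smul_left, inner_smul_right,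
    a.inner_origin_dir, h, real_inner_self_eq_norm_sq, a.norm_origin, a.norm_dir, cos_sub]
  simp

lemma norm_point (a : GreatArc) (t : ℝ) : ‖a.point t‖ = 1 := by
  have h := a.inner_point t t
  rw [real_inner_self_eq_norm_sq, sub_self, cos_zero] at h
  nlinarith [norm_nonneg (a.point t)]

lemma norm_along (a : GreatArc) (d : Bool) (s : ℝ) : ‖a.along d s‖ = 1 := a.norm_point _

lemma along_injOn (a : GreatArc) (d : Bool) : InjOn (a.along d) (Icc 0 a.len) := by
  have key : ∀ s ∈ Icc 0 a.len, ∀ t ∈ Icc 0 a.len, a.point s = a.point t → s = t := by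
    intro s hs t ht h
    have h1 : cos (t - s) = 1 := by rw [← inner_point, h, inner_point, sub_self, cos_zero]
    have hl := a.len_lt
    have h2 := (cos_eq_one_iff_of_lt_of_lt (by linarith [hs.2, ht.1])
      (by linarith [hs.1, ht.2])).1 h1
    linarith
  intro s hs t ht h
  cases d
  · have := key (a.len - s) ⟨by linarith [hs.2], by linarith [hs.1]⟩ (a.len - t)
      ⟨by linarith [ht.2], by linarith [ht.1]⟩ (by simpa [along] using h)
    linarith
  · exact key s hs t ht (by simpa [along] using h)

/-- A unit vector in the cone of two points of an arc, not a multiple of the second one, is on the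
arc between them, before the second one. -/
lemma exists_along_eq (a : GreatArc) (d : Bool) {s t β γ : ℝ} (hst : s < t) (hπ : t - s < π)
    (hβ : 0 < β) (hγ : 0 ≤ γ) {p : E3} (hp : ‖p‖ = 1)
    (h : p = β • a.along d s + γ • a.along d t) : ∃ r ∈ Ico s t, p = a.along d r := by
  -- work with the frame at parameter `s`
  obtain ⟨f, hf⟩ : ∃ f : E3, ∀ r, a.along d (s + r) = cos r • a.along d s + sin r • f := by
    cases d
    · refine ⟨sin (a.len - s) • a.origin - cos (a.len - s) • a.dir, fun r => ?_⟩
      simp only [along, point, Bool.false_eq_true, if_false]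
      rw [show a.len - (s + r) = (a.len - s) - r by ring]
      generalize a.len - s = q
      rw [cos_sub, sin_sub]
      module
    · refine ⟨-sin s • a.origin + cos s • a.dir, fun r => ?_⟩
      simp only [along, point, if_true]
      rw [cos_add, sin_add]
      module
  set δ := t - s with hδ
  have hδ0 : 0 < δ := by linarith
  have hsin : 0 < sin δ := sin_pos_of_pos_of_lt_pi hδ0 hπ
  have hp1 : p = (β + γ * cos δ) • a.along d s + (γ * sin δ) • f := by
    rw [h, show t = s + δ by ring, hf δ]; module
  have hsq : (β + γ * cos δ) ^ 2 + (γ * sin δ) ^ 2 = 1 := by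
    have h1 : inner ℝ (a.along d s) (a.along d t) = cos δ := by
      cases d
      · simp only [along, inner_point, Bool.false_eq_true, if_false]
        rw [← cos_neg]; congr 1; ring
      · simp [along, inner_point, hδ]
    have h2 : (1 : ℝ) = inner ℝ p p := by rw [real_inner_self_eq_norm_sq, hp]; norm_num
    have h3 : inner ℝ p p = β ^ 2 + 2 * β * γ * cos δ + γ ^ 2 := by
      rw [h]
      simp only [inner_add_left, inner_add_right, inner_smul_left, inner_smul_right,
        real_inner_self_eq_norm_sq, norm_along, h1, real_inner_comm (a.along d s) (a.along d t)]
      simp; ring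
    rw [h3] at h2
    have := sin_sq_add_cos_sq δ
    rw [h2]
    linear_combination γ ^ 2 * this
  have hc1 : -1 ≤ β + γ * cos δ := by nlinarith [sq_nonneg (γ * sin δ)]
  have hc2 : β + γ * cos δ ≤ 1 := by nlinarith [sq_nonneg (γ * sin δ)]
  set τ := arccos (β + γ * cos δ) with hτ
  have hcos : cos τ = β + γ * cos δ := cos_arccos hc1 hc2
  have hsinτ : sin τ = γ * sin δ := by
    rw [hτ, sin_arccos, show 1 - (β + γ * cos δ) ^ 2 = (γ * sin δ) ^ 2 by linarith]
    exact Real.sqrt_sq (by positivity)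
  have hτ0 : 0 ≤ τ := arccos_nonneg _
  have hτπ : τ ≤ π := arccos_le_pi _
  -- Otherwise `sin (τ - δ)` would be nonnegative, whereas it equals `-(β * sin δ)`.
  have hlt : τ < δ := by
    by_contra hcon
    have h1 : sin (τ - δ) = -(β * sin δ) := by rw [sin_sub, hcos, hsinτ]; ring
    have h2 : 0 ≤ sin (τ - δ) := sin_nonneg_of_nonneg_of_le_pi (by linarith) (by linarith)
    have : 0 < β * sin δ := by positivity
    linarith
  refine ⟨s + τ, ⟨by linarith, by linarith⟩, ?_⟩
  rw [hf τ, hcos, hsinτ, hp1]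

end GreatArc

/-! ### Incidence data of a diagram -/

/-- The incidence data of a spherical occlusion diagram: the arc that each end of an arc feeds
into, and the side from which an arc is fed. -/
structure Wiring (S : Finset GreatArc) where
  fed : S → Bool
  tgt : Bool → S → S
  short : ∀ a : S, a.1.len < π
  eq_of_mem : ∀ {a b : S} {p : E3}, p ∈ a.1.relInterior → p ∈ b.1.relInterior → a = b
  head_mem : ∀ (d : Bool) (a : S), a.1.head d ∈ (tgt d a).1.relInterior
  subset_leftOf : ∀ {a b : S}, FeedsInto a.1 b.1 → a.1.relInterior ⊆ b.1.leftOf (fed b)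
  tgt_ne : ∀ {d d' : Bool} (a : S), d ≠ d' → tgt d a ≠ tgt d' a

lemma IsSOD.nonempty_wiring {S : Finset GreatArc} (hS : IsSOD S) : Nonempty (Wiring S) := by
  have huniq : ∀ {a b : S} {p : E3}, p ∈ a.1.relInterior → p ∈ b.1.relInterior → a = b := by
    intro a b p ha hb
    by_contra h
    exact Set.disjoint_left.1 (hS.disjoint a a.2 b b.2 fun h' => h (Subtype.ext h')) ha hb
  have key : ∀ a : S, ∃ f : Bool → S, (∀ d, a.1.head d ∈ (f d).1.relInterior) ∧
      ∀ d d', d ≠ d' → f d ≠ f d' := by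
    intro a
    obtain ⟨b, c, hbc, h⟩ := Set.encard_eq_two.1 (hS.feeds_two a a.2)
    have hb : b ∈ ({b | b ∈ S ∧ FeedsInto a.1 b} : Set GreatArc) := by rw [h]; simp
    have hc : c ∈ ({b | b ∈ S ∧ FeedsInto a.1 b} : Set GreatArc) := by rw [h]; simp
    obtain ⟨hbS, d, hd⟩ := hb
    obtain ⟨hcS, d', hd'⟩ := hc
    -- Internal disjointness lets one end lie in only one interior, so the two arcs that are fed
    -- belong to different ends.
    have hdd : d' = !d := by
      have : d' ≠ d := by
        rintro rfl
        exact hbc (congrArg Subtype.val (huniq (a := ⟨b, hbS⟩) (b := ⟨c, hcS⟩) hd hd'))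
      revert this; cases d <;> cases d' <;> simp
    subst hdd
    refine ⟨fun k => if k = d then ⟨b, hbS⟩ else ⟨c, hcS⟩, fun k => ?_, fun k k' hk => ?_⟩
    · by_cases hkd : k = d
      · simpa [hkd] using hd
      · rw [show k = !d by cases k <;> cases d <;> simp_all]
        simpa using hd'
    · have hne : (⟨b, hbS⟩ : S) ≠ ⟨c, hcS⟩ := fun h => hbc (congrArg Subtype.val h)
      cases k <;> cases k' <;> cases d <;>
        first | exact absurd rfl hk | exact hne | exact hne.symm
  choose f hf hne using key
  choose g hg using fun b : S => hS.same_side b b.2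
  exact ⟨⟨g, fun d a => f a d, fun a => hS.short a a.2, huniq, fun d a => hf a d,
    fun {a b} h => hg b a a.2 h, fun a h => hne a _ _ h⟩⟩

/-! ### The walk around an observer and the region that it hides -/

/-- A sign for the sense of the turns: `true` stands for right turns. -/
def sgn (e : Bool) : ℝ := if e then 1 else -1

lemma sgn_mul_self (e : Bool) : sgn e * sgn e = 1 := by cases e <;> simp [sgn]

lemma sgn_ne_zero (e : Bool) : sgn e ≠ 0 := by cases e <;> simp [sgn]

lemma GreatArc.lside_eq_sgn_mul (a : GreatArc) {d d' e : Bool} (h : (d ^^ e) = !d') (y : E3) :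
    a.lside d' y = sgn e * a.lside d y := by
  revert h; cases e <;> cases d <;> cases d' <;> simp [sgn, lside]

namespace Wiring

variable {S : Finset GreatArc} (W : Wiring S) (e : Bool) (x : E3)

/-- The direction in which an arc is traversed after a right turn (`e = true`) or a left turn
(`e = false`) onto it. -/
def walkDir (a : S) : Bool := W.fed a ^^ e

/-- The next arc of the walk that always turns in the sense `e`. -/
def walk (a : S) : S := W.tgt (W.walkDir e a) a

/-- The direction in which an arc goes around `x`, counterclockwise for `e = true`. -/
def spinDir (a : S) : Bool := decide (0 < a.1.side x) ^^ !e

/-- The next arc of the walk that goes around `x` in the sense determined by `e`. -/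
def spin (a : S) : S := W.tgt (spinDir e x a) a

/-- The end of an arc that is directed around `x`. -/
def tip (a : S) : E3 := a.1.head (spinDir e x a)

/-- The cone of two consecutive tips and `-x`: the piece of the next arc between these tips and
what it hides from an observer in direction `x`. -/
def shadow (a : S) : Set E3 :=
  {p | 0 ≤ sgn e * det3 x (tip e x a) p ∧ 0 ≤ sgn e * det3 x p (tip e x (W.spin e x a)) ∧
    0 ≤ -(sgn e * det3 (tip e x a) (tip e x (W.spin e x a)) p)}

/-- The union of the shadows over the arcs in the cycles of the walk around `x`. -/
def region : Set E3 := ⋃ a ∈ Function.periodicPts (W.spin e x), W.shadow e x a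

variable {x}

lemma isClosed_shadow (a : S) : IsClosed (W.shadow e x a) := by
  refine IsClosed.and ?_ (IsClosed.and ?_ ?_)
  · exact isClosed_le continuous_const (continuous_const.mul (continuous_det3 _ _))
  · exact isClosed_le continuous_const (continuous_const.mul (continuous_det3_mid _ _))
  · exact isClosed_le continuous_const (continuous_const.mul (continuous_det3 _ _)).neg

lemma isClosed_region : IsClosed (W.region e x) :=
  (Set.toFinite _).isClosed_biUnion fun a _ => W.isClosed_shadow e a

lemma spin_lside_pos (hx : ∀ a : S, a.1.side x ≠ 0) (a : S) :
    0 < sgn e * a.1.lside (spinDir e x a) x := by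
  rcases lt_or_gt_of_ne (hx a) with h | h
  · cases e <;> simp [sgn, spinDir, lside, h, not_lt.2 h.le]
  · cases e <;> simp [sgn, spinDir, lside, h]

lemma exists_tip_eq (a : S) : ∃ s ∈ Ioo 0 (W.spin e x a).1.len,
    (W.spin e x a).1.along (spinDir e x (W.spin e x a)) s = tip e x a := by
  have h := W.head_mem (spinDir e x a) a
  rwa [(W.tgt (spinDir e x a) a).1.relInterior_eq (spinDir e x (W.spin e x a))] at h

lemma tip_eq (a : S) : tip e x a = a.1.along (spinDir e x a) a.1.len := head_eq _ _

/-- Consecutive tips lie on one arc shorter than a semicircle, traversed around `x` in the sense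
`e`. The value is the denominator in Cramer's rule for the basis of `x` and the two tips. -/
lemma spin_det_pos (hx : ∀ a : S, a.1.side x ≠ 0) (a : S) :
    0 < sgn e * det3 x (tip e x a) (tip e x (W.spin e x a)) := by
  obtain ⟨s, hs, h⟩ := W.exists_tip_eq e (x := x) a
  rw [det3_rotate, ← h, tip_eq, det3_along, mul_left_comm]
  have := W.short (W.spin e x a)
  exact mul_pos (sin_pos_of_pos_of_lt_pi (by linarith [hs.2]) (by linarith [hs.1, hs.2]))
    (spin_lside_pos e hx _)

/-- This piece of the next arc is the face of the cone spanned by the two tips: the third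
determinant vanishes and the other two are sines of lengths below `π` times a positive side. -/
lemma mem_shadow_along {a : S} (hx : ∀ a : S, a.1.side x ≠ 0) {s r : ℝ} (hs : 0 < s)
    (h : (W.spin e x a).1.along (spinDir e x (W.spin e x a)) s = tip e x a)
    (hr : r ∈ Icc s (W.spin e x a).1.len) :
    (W.spin e x a).1.along (spinDir e x (W.spin e x a)) r ∈ W.shadow e x a := by
  have hl := W.short (W.spin e x a)
  have hpos := spin_lside_pos e hx (W.spin e x a)
  refine ⟨?_, ?_, ?_⟩
  · rw [det3_rotate, ← h, det3_along, mul_left_comm]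
    exact mul_nonneg (sin_nonneg_of_nonneg_of_le_pi (by linarith [hr.1])
      (by linarith [hr.2])) hpos.le
  · rw [det3_rotate, tip_eq, det3_along, mul_left_comm]
    exact mul_nonneg (sin_nonneg_of_nonneg_of_le_pi (by linarith [hr.2])
      (by linarith [hr.1])) hpos.le
  · rw [← h, tip_eq, det3_along, lside_along]; simp

lemma tip_mem_shadow (hx : ∀ a : S, a.1.side x ≠ 0) (a : S) : tip e x a ∈ W.shadow e x a := by
  obtain ⟨s, hs, h⟩ := W.exists_tip_eq e (x := x) a
  rw [← h]
  exact W.mem_shadow_along e hx hs.1 h ⟨le_rfl, hs.2.le⟩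

lemma exists_pred {a : S} (ha : a ∈ Function.periodicPts (W.spin e x)) :
    ∃ b ∈ Function.periodicPts (W.spin e x), W.spin e x b = a :=
  (Function.bijOn_periodicPts (W.spin e x)).surjOn ha

lemma spin_mem {a : S} (ha : a ∈ Function.periodicPts (W.spin e x)) :
    W.spin e x a ∈ Function.periodicPts (W.spin e x) :=
  (Function.bijOn_periodicPts (W.spin e x)).mapsTo ha

lemma mem_region {a : S} (ha : a ∈ Function.periodicPts (W.spin e x)) {p : E3}
    (hp : p ∈ W.shadow e x a) : p ∈ W.region e x :=
  mem_biUnion ha hp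

/-- A point of a shadow that is not strictly behind the arc is on the arc, before its tip. -/
lemma exists_along_of_mem_shadow (hx : ∀ a : S, a.1.side x ≠ 0) {a : S}
    (ha : a ∈ Function.periodicPts (W.spin e x)) {p : E3} (hp1 : ‖p‖ = 1)
    (hp : p ∈ W.shadow e x a)
    (h0 : det3 (tip e x a) (tip e x (W.spin e x a)) p = 0) :
    ∃ b ∈ Function.periodicPts (W.spin e x), ∃ s r : ℝ, 0 < s ∧ s ≤ r ∧
      r < (W.spin e x b).1.len ∧
      (W.spin e x b).1.along (spinDir e x (W.spin e x b)) s = tip e x b ∧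
      (W.spin e x b).1.along (spinDir e x (W.spin e x b)) r = p := by
  have hD := W.spin_det_pos e hx a
  set D := sgn e * det3 x (tip e x a) (tip e x (W.spin e x a))
  obtain ⟨hΓ, hB, -⟩ := hp
  set Γ := sgn e * det3 x (tip e x a) p
  set B := sgn e * det3 x p (tip e x (W.spin e x a))
  have hc : D • p = B • tip e x a + Γ • tip e x (W.spin e x a) := by
    have := congrArg (fun q => sgn e • q)
      (det3_cramer x (tip e x a) (tip e x (W.spin e x a)) p)
    simpa only [h0, zero_smul, zero_add, smul_add, smul_smul] using this
  have hc' : p = (B / D) • tip e x a + (Γ / D) • tip e x (W.spin e x a) := by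
    have := congrArg (fun q => D⁻¹ • q) hc
    simpa only [smul_smul, smul_add, inv_mul_cancel₀ hD.ne', one_smul, inv_mul_eq_div] using this
  obtain ⟨s, hs, h⟩ := W.exists_tip_eq e (x := x) a
  rcases hB.lt_or_eq with hB | hB
  · rw [tip_eq e (W.spin e x a), ← h] at hc'
    obtain ⟨r, hr, hpr⟩ := (W.spin e x a).1.exists_along_eq _ hs.2
      (by linarith [W.short (W.spin e x a), hs.1]) (div_pos hB hD) (div_nonneg hΓ hD.le) hp1 hc'
    exact ⟨a, ha, s, r, hs.1, hr.1, hr.2, h, hpr.symm⟩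
  -- Here the point is the second tip. It is counted as the entry point of the following arc, which
  -- keeps `r` strictly below the length.
  · rw [← hB, zero_div, zero_smul, zero_add] at hc'
    have h1 : Γ / D = 1 := by
      have := congrArg norm hc'
      rw [hp1, norm_smul, tip_eq, norm_along, mul_one, Real.norm_eq_abs,
        abs_of_nonneg (div_nonneg hΓ hD.le)] at this
      exact this.symm
    rw [h1, one_smul] at hc'
    obtain ⟨s', hs', h'⟩ := W.exists_tip_eq e (x := x) (W.spin e x a)
    exact ⟨_, W.spin_mem e ha, s', s', hs'.1, le_rfl, hs'.2, h', by rw [h', hc']⟩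

/-- A point strictly behind one of the arcs of the walk around `x` is interior to the region,
unless it is a multiple of `x`. -/
lemma region_mem_nhds (hx : ∀ a : S, a.1.side x ≠ 0) {a : S}
    (ha : a ∈ Function.periodicPts (W.spin e x)) {p : E3} (hp : p ∈ W.shadow e x a)
    (h0 : 0 < -(sgn e * det3 (tip e x a) (tip e x (W.spin e x a)) p))
    (hpx : ∀ c : ℝ, p ≠ c • x) : W.region e x ∈ 𝓝 p := by
  have hD := W.spin_det_pos e hx a
  obtain ⟨b, hb, rfl⟩ := W.exists_pred e ha
  set a := W.spin e x b
  set c := W.spin e x a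
  have hDb := W.spin_det_pos e hx b
  have hDc := W.spin_det_pos e hx c
  set t := tip e x b
  set u := tip e x a
  set v := tip e x c
  set w := tip e x (W.spin e x c)
  set σ := sgn e
  have hcram : (σ * det3 x u v) • p =
      (σ * det3 u v p) • x + (σ * det3 x p v) • u + (σ * det3 x u p) • v := by
    have := congrArg (fun q => σ • q) (det3_cramer x u v p)
    simpa only [smul_add, smul_smul] using this
  obtain ⟨hΓ, hB, -⟩ := hp
  have cont1 : ∀ y z : E3, Tendsto (fun q => σ * det3 y z q) (𝓝 p) (𝓝 (σ * det3 y z p)) :=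
    fun y z => (continuous_const.mul (continuous_det3 y z)).tendsto p
  have cont2 : ∀ y z : E3, Tendsto (fun q => σ * det3 y q z) (𝓝 p) (𝓝 (σ * det3 y p z)) :=
    fun y z => (continuous_const.mul (continuous_det3_mid y z)).tendsto p
  have evA := (cont1 u v).neg.eventually (lt_mem_nhds h0)
  rcases hΓ.lt_or_eq with hΓ | hΓ
  · have evΓ := (cont1 x u).eventually (lt_mem_nhds hΓ)
    rcases hB.lt_or_eq with hB | hB
    · filter_upwards [evA, evΓ, (cont2 x v).eventually (lt_mem_nhds hB)] with q h1 h2 h3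
      exact W.mem_region e ha ⟨h2.le, h3.le, h1.le⟩
    · -- on the meridian of the second tip
      have hB' : det3 x p v = 0 := by
        rcases mul_eq_zero.1 hB.symm with h | h
        · exact absurd h ((sgn_ne_zero e))
        · exact h
      rw [hB', mul_zero, zero_smul, add_zero] at hcram
      -- In the plane of `x` and `u` or of `x` and `v`, the signs with respect to a neighbouring
      -- shadow follow from the coordinates of `p`.
      have hA'' : 0 < -(σ * det3 v w p) := by
        have h1 := congrArg (det3 v w) hcram
        rw [det3_smul, det3_add, det3_smul, det3_smul, det3_self_outer,
          ← det3_rotate x v w] at h1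
        refine (mul_pos_iff_of_pos_left hD).1 ((mul_pos h0 hDc).trans_eq ?_)
        linear_combination σ * h1
      have hB'' : 0 < σ * det3 x p w := by
        have h1 := congrArg (det3 w x) hcram
        rw [det3_smul, det3_add, det3_smul, det3_smul, det3_self_right,
          det3_rotate w x p, det3_rotate w x v] at h1
        refine (mul_pos_iff_of_pos_left hD).1 ((mul_pos hΓ hDc).trans_eq ?_)
        linear_combination -σ * h1
      filter_upwards [evA, evΓ, (cont1 v w).neg.eventually (lt_mem_nhds hA''),
        (cont2 x w).eventually (lt_mem_nhds hB'')] with q h1 h2 h3 h4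
      -- The meridian through `v` separates the shadow of `a` from the next one, and nearby points
      -- fall into one or the other.
      rcases le_total 0 (σ * det3 x q v) with h | h
      · exact W.mem_region e ha ⟨h2.le, h, h1.le⟩
      · refine W.mem_region e (W.spin_mem e ha) ⟨?_, h4.le, h3.le⟩
        change 0 ≤ σ * det3 x v q
        rw [det3_swap]; linarith
  · -- on the meridian of the first tip
    have hΓ' : det3 x u p = 0 := by
      rcases mul_eq_zero.1 hΓ.symm with h | h
      · exact absurd h ((sgn_ne_zero e))
      · exact h
    rw [hΓ', mul_zero, zero_smul, add_zero] at hcram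
    have hB : 0 < σ * det3 x p v := by
      refine hB.lt_of_ne fun h => ?_
      rw [← h, zero_smul, add_zero] at hcram
      refine hpx ((σ * det3 x u v)⁻¹ * (σ * det3 u v p)) ?_
      rw [← smul_smul, ← hcram, smul_smul, inv_mul_cancel₀ hD.ne', one_smul]
    have hA' : 0 < -(σ * det3 t u p) := by
      have h1 := congrArg (det3 t u) hcram
      rw [det3_smul, det3_add, det3_smul, det3_smul, det3_self_right,
        ← det3_rotate x t u] at h1
      refine (mul_pos_iff_of_pos_left hD).1 ((mul_pos h0 hDb).trans_eq ?_)
      linear_combination σ * h1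
    have hΓ'' : 0 < σ * det3 x t p := by
      have h1 := congrArg (det3 x t) hcram
      rw [det3_smul, det3_add, det3_smul, det3_smul, det3_self_outer] at h1
      refine (mul_pos_iff_of_pos_left hD).1 ((mul_pos hB hDb).trans_eq ?_)
      linear_combination -σ * h1
    filter_upwards [evA, (cont2 x v).eventually (lt_mem_nhds hB),
      (cont1 t u).neg.eventually (lt_mem_nhds hA'),
      (cont1 x t).eventually (lt_mem_nhds hΓ'')] with q h1 h2 h3 h4
    rcases le_total 0 (σ * det3 x u q) with h | h
    · exact W.mem_region e ha ⟨h, h2.le, h1.le⟩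
    · refine W.mem_region e hb ⟨h4.le, ?_, h3.le⟩
      change 0 ≤ σ * det3 x q u
      rw [det3_swap]; linarith

/-- A walk that always turns in the sense `e` cannot leave the region at an interior point of an
arc. -/
lemma eventually_along_mem_region (hx : ∀ a : S, a.1.side x ≠ 0) (a : S) {s : ℝ}
    (hs : s ∈ Ioo 0 a.1.len) (h : a.1.along (W.walkDir e a) s ∈ W.region e x) :
    ∀ᶠ r in 𝓝[>] s, a.1.along (W.walkDir e a) r ∈ W.region e x := by
  have hcont := (a.1.continuous_along (W.walkDir e a)).tendsto s
  obtain ⟨b, hb, hp⟩ : ∃ b ∈ Function.periodicPts (W.spin e x),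
      a.1.along (W.walkDir e a) s ∈ W.shadow e x b := by simpa [region] using h
  rcases hp.2.2.lt_or_eq with h0 | h0
  · refine nhdsWithin_le_nhds (hcont (W.region_mem_nhds e hx hb hp h0 fun c hc => ?_))
    have h1 : a.1.lside true (a.1.along (W.walkDir e a) s) = 0 := lside_along _ _ _ _
    rw [hc] at h1
    simp only [lside, side_eq, det3_smul, if_true] at h1
    rcases mul_eq_zero.1 h1 with h2 | h2
    · have h3 := a.1.norm_along (W.walkDir e a) s
      rw [hc, h2, zero_smul, norm_zero] at h3
      exact zero_ne_one h3
    · exact hx a h2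
  have h0' : det3 (tip e x b) (tip e x (W.spin e x b)) (a.1.along (W.walkDir e a) s) = 0 := by
    rcases mul_eq_zero.1 (neg_eq_zero.1 h0.symm) with h | h
    · exact absurd h ((sgn_ne_zero e))
    · exact h
  obtain ⟨c, hc, u, r, hu, hur, hr, htip, hpr⟩ :=
    W.exists_along_of_mem_shadow e hx hb (a.1.norm_along _ _) hp h0'
  have hac : W.spin e x c = a := by
    refine W.eq_of_mem (p := a.1.along (W.walkDir e a) s) ?_ ?_
    · rw [relInterior_eq _ (spinDir e x (W.spin e x c))]
      exact ⟨r, ⟨by linarith, hr⟩, hpr⟩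
    · rw [relInterior_eq _ (W.walkDir e a)]
      exact ⟨s, hs, rfl⟩
  obtain ⟨t, ht, htc⟩ := W.exists_pred e hc
  have hl := W.short a
  by_cases hdir : W.walkDir e a = spinDir e x a
  · -- the walk follows the arc towards its tip
    have hrs : r = s := by
      subst hac
      rw [hdir] at hpr
      exact along_injOn _ _ ⟨by linarith, hr.le⟩ ⟨hs.1.le, hs.2.le⟩ hpr
    subst hrs
    filter_upwards [Ioo_mem_nhdsGT hs.2] with q hq
    refine W.mem_region e hc ?_
    subst hac
    rw [hdir]
    exact W.mem_shadow_along e hx hu htip ⟨by linarith [hq.1], hq.2.le⟩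
  · have hdir' : W.walkDir e a = !spinDir e x a := by
      revert hdir; cases W.walkDir e a <;> cases spinDir e x a <;> simp
    have hrs : r = a.1.len - s := by
      subst hac
      rw [hdir', along_not] at hpr
      exact along_injOn _ _ ⟨by linarith, hr.le⟩ ⟨by linarith [hs.2], by linarith [hs.1]⟩ hpr
    rcases hur.lt_or_eq with hur | hur
    · -- the walk follows the arc away from its tip
      filter_upwards [Ioo_mem_nhdsGT (show s < a.1.len - u by linarith)] with q hq
      refine W.mem_region e hc ?_
      subst hac
      rw [hdir', along_not]
      exact W.mem_shadow_along e hx hu htip ⟨by linarith [hq.2], by linarith [hq.1, hs.1]⟩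
    · -- the walk passes the point where the previous arc of the cycle arrives
      have hp' : a.1.along (W.walkDir e a) s = tip e x c := by
        rw [← hpr, ← hur, htip]
      have hDt := W.spin_det_pos e hx t
      rw [htc] at hDt
      have hΓ : ∀ᶠ q in 𝓝[>] s,
          0 < sgn e * det3 x (tip e x t) (a.1.along (W.walkDir e a) q) := by
        refine nhdsWithin_le_nhds (hcont.eventually (p := fun y => 0 < sgn e * det3 x (tip e x t) y)
          ((continuous_const.mul (continuous_det3 x _)).tendsto _ |>.eventually
            (lt_mem_nhds ?_)))
        rwa [hp']
      filter_upwards [hΓ, Ioo_mem_nhdsGT hs.2] with q hq1 hq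
      refine W.mem_region e ht ⟨hq1.le, ?_, ?_⟩
      · rw [htc, ← htip]
        have hpos := spin_lside_pos e hx a
        subst hac
        rw [hdir', along_not, det3_rotate, det3_along, mul_left_comm]
        exact mul_nonneg (sin_nonneg_of_nonneg_of_le_pi (by linarith [hq.1])
          (by linarith [hq.2, hq.1, hs.1])) hpos.le
      · rw [htc, ← htip]
        -- Here the common side of arrival and the sense of turning enter: as the walk runs against
        -- the spin, the fed side is the side of `x`. So `c` arrives from there, and the
        -- continuation past its tip lies behind it.
        have hmem : tip e x t ∈ (W.spin e x c).1.leftOf (W.fed (W.spin e x c)) := by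
          refine W.subset_leftOf ⟨_, W.head_mem (spinDir e x c) c⟩ ?_
          have := W.head_mem (spinDir e x t) t
          rwa [show W.tgt (spinDir e x t) t = c from htc] at this
        subst hac
        rw [mem_leftOf] at hmem
        have hside : 0 < sgn e *
            (W.spin e x c).1.lside (spinDir e x (W.spin e x c)) (tip e x t) := by
          rw [lside_eq_sgn_mul _ hdir', ← mul_assoc, sgn_mul_self, one_mul]
          exact hmem
        rw [hdir', along_not, det3_rotate, det3_along, mul_left_comm,
          show (W.spin e x c).1.len - q - u = -(q - s) by linarith, sin_neg, neg_mul, neg_neg]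
        exact mul_nonneg (sin_nonneg_of_nonneg_of_le_pi (by linarith [hq.1])
          (by linarith [hq.2, hq.1, hs.1])) hside.le

/-- A walk that always turns in the sense `e` stays in the region along each arc. -/
lemma along_mem_region (hx : ∀ a : S, a.1.side x ≠ 0) (a : S) {s : ℝ}
    (hs : s ∈ Ioo 0 a.1.len) (h : a.1.along (W.walkDir e a) s ∈ W.region e x) :
    ∀ r ∈ Icc s a.1.len, a.1.along (W.walkDir e a) r ∈ W.region e x := by
  set T := a.1.along (W.walkDir e a) ⁻¹' W.region e x
  -- A closed set of parameters that contains a right neighbourhood of each of its points before the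
  -- end fills the interval.
  have hT : IsClosed T := (W.isClosed_region e).preimage (a.1.continuous_along _)
  refine (hT.inter isClosed_Icc).Icc_subset_of_forall_mem_nhdsWithin h fun r hr => ?_
  exact W.eventually_along_mem_region e hx a ⟨by linarith [hs.1, hr.2.1], hr.2.2⟩ hr.1

end Wiring

/-! ### The choice of the observer and the trapped walk -/

lemma GreatArc.exists_side_ne_zero (a : GreatArc) : ∃ z, a.side z ≠ 0 := by
  set u := a.origin with hu
  set v := a.dir with hv
  -- The witness is the cross product; its side is the Gram determinant of an orthonormal pair,
  -- which is 1.
  refine ⟨!₂[u 1 * v 2 - u 2 * v 1, u 2 * v 0 - u 0 * v 2, u 0 * v 1 - u 1 * v 0], ?_⟩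
  have h1 : u 0 ^ 2 + u 1 ^ 2 + u 2 ^ 2 = 1 := by
    have := EuclideanSpace.real_norm_sq_eq u
    rw [a.norm_origin, Fin.sum_univ_three] at this
    linarith
  have h2 : v 0 ^ 2 + v 1 ^ 2 + v 2 ^ 2 = 1 := by
    have := EuclideanSpace.real_norm_sq_eq v
    rw [a.norm_dir, Fin.sum_univ_three] at this
    linarith
  have h3 : u 0 * v 0 + u 1 * v 1 + u 2 * v 2 = 0 := by
    have := a.inner_origin_dir
    rw [PiLp.inner_apply, Fin.sum_univ_three] at this
    simp only [RCLike.inner_apply, conj_trivial] at this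
    linarith
  rw [side_eq, det3_apply]
  simp only [Matrix.cons_val_zero, Matrix.cons_val_one, Matrix.cons_val]
  have : (1 : ℝ) = (u 0 ^ 2 + u 1 ^ 2 + u 2 ^ 2) * (v 0 ^ 2 + v 1 ^ 2 + v 2 ^ 2)
      - (u 0 * v 0 + u 1 * v 1 + u 2 * v 2) ^ 2 := by rw [h1, h2, h3]; norm_num
  refine ne_of_eq_of_ne ?_ one_ne_zero
  rw [this]; ring

/-- Some vector is not on the great circle of any arc of a finite set. -/
lemma exists_forall_side_ne_zero (S : Finset GreatArc) : ∃ z, ∀ a ∈ S, a.side z ≠ 0 := by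
  classical
  let f : GreatArc → Submodule ℝ E3 := fun a =>
    { carrier := {z | a.side z = 0}
      add_mem' := fun {x y} hx hy => by
        simp only [Set.mem_ofPred_eq, side_eq] at *
        rw [det3_add, hx, hy, add_zero]
      zero_mem' := by simp [side_eq, det3_apply]
      smul_mem' := fun c x hx => by
        simp only [Set.mem_ofPred_eq, side_eq] at *
        rw [det3_smul, hx, mul_zero] }
  -- A real vector space is not a finite union of proper subspaces.
  have h := Subspace.biUnion_ne_univ_of_top_notMem (s := S.image f) (by
    rw [Finset.mem_image]
    rintro ⟨a, -, ha⟩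
    obtain ⟨z, hz⟩ := a.exists_side_ne_zero
    have : z ∈ f a := by rw [ha]; trivial
    exact hz this)
  obtain ⟨z, hz⟩ := (ne_univ_iff_exists_notMem _).1 h
  refine ⟨z, fun a ha h0 => hz ?_⟩
  exact mem_biUnion (Finset.mem_coe.2 (Finset.mem_image_of_mem f ha)) h0

namespace Wiring

variable {S : Finset GreatArc} (W : Wiring S) (e : Bool)

/-- Seen from a suitable direction, the last piece of an arc `c` is not in the region, and `c` is
directed against its traversal by the walk. -/
lemma exists_observer (c : S) : ∃ (x : E3) (s : ℝ), (∀ a : S, a.1.side x ≠ 0) ∧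
    s ∈ Ioo 0 c.1.len ∧ c.1.along (W.walkDir e c) s ∉ W.region e x ∧
    ∀ (a : S) (d : Bool) (r : ℝ), r ∈ Ioo 0 c.1.len →
      c.1.along (W.walkDir e c) r = a.1.head d → r < s := by
  have h1 : ∀ (a : S) (d : Bool), ∀ᶠ s in 𝓝[<] c.1.len, ∀ r ∈ Ioo 0 c.1.len,
      c.1.along (W.walkDir e c) r = a.1.head d → r < s := by
    intro a d
    by_cases h : ∃ r ∈ Ioo 0 c.1.len, c.1.along (W.walkDir e c) r = a.1.head d
    · obtain ⟨r, hr, hra⟩ := h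
      filter_upwards [Ioo_mem_nhdsLT hr.2] with s hs q hq hqa
      rw [along_injOn _ _ (Ioo_subset_Icc_self hq) (Ioo_subset_Icc_self hr) (hqa.trans hra.symm)]
      exact hs.1
    · exact Eventually.of_forall fun s r hr hra => absurd ⟨r, hr, hra⟩ h
  obtain ⟨s, hfeed, hs⟩ := ((eventually_all.2 fun a => eventually_all.2 (h1 a)).and
    (Ioo_mem_nhdsLT c.1.len_pos)).exists
  set p := c.1.along (W.walkDir e c) s with hp
  -- Shifting `p` slightly along `z` puts the observer on the fed side of `c`, which makes the spin
  -- on `c` opposite to the walk.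
  obtain ⟨z, hz, hzc⟩ : ∃ z, (∀ a : S, a.1.side z ≠ 0) ∧ decide (0 < c.1.side z) = W.fed c := by
    obtain ⟨z, hz⟩ := exists_forall_side_ne_zero S
    have hneg : ∀ a : GreatArc, a.side (-z) = -a.side z := fun a => by
      rw [side_eq, side_eq, ← neg_one_smul ℝ z, det3_smul]; ring
    by_cases h : decide (0 < c.1.side z) = W.fed c
    · exact ⟨z, fun a => hz a a.2, h⟩
    · refine ⟨-z, fun a => by rw [hneg]; exact neg_ne_zero.2 (hz a a.2), ?_⟩
      rw [hneg]
      revert h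
      rcases lt_or_gt_of_ne (hz c c.2) with h0 | h0
      · cases W.fed c <;> simp [h0, h0.le]
      · cases W.fed c <;> simp [h0, h0.le]
  -- For small `η` no great circle that misses `p` separates `x` from `p`.
  have h2 : ∀ a : S, ∀ᶠ η in 𝓝[>] (0 : ℝ), a.1.side p ≠ 0 →
      0 < a.1.side p * a.1.side (p + η • z) := by
    intro a
    by_cases h : a.1.side p = 0
    · exact Eventually.of_forall fun η h' => absurd h h'
    · have hc : Continuous fun η : ℝ => a.1.side p * a.1.side (p + η • z) :=
        continuous_const.mul ((continuous_det3 _ _).comp (by fun_prop))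
      have ht := hc.tendsto 0
      simp only [zero_smul, add_zero] at ht
      filter_upwards [nhdsWithin_le_nhds (ht.eventually (lt_mem_nhds (mul_self_pos.2 h)))]
        with η hη _ using hη
  obtain ⟨η, hη, hη0⟩ := ((eventually_all.2 h2).and self_mem_nhdsWithin).exists
  replace hη0 : 0 < η := hη0
  have hside : ∀ a : S, a.1.side (p + η • z) = a.1.side p + η * a.1.side z := fun a => by
    simp only [side_eq, det3_add, det3_smul]
  set x := p + η • z
  have hx : ∀ a : S, a.1.side x ≠ 0 := by
    intro a
    by_cases h : a.1.side p = 0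
    · rw [hside, h, zero_add]; exact mul_ne_zero hη0.ne' (hz a)
    · exact (mul_ne_zero_iff.1 (hη a h).ne').2
  have hdir : W.walkDir e c = !spinDir e x c := by
    have : decide (0 < c.1.side x) = W.fed c := by
      rw [hside, show c.1.side p = 0 from c.1.side_point _, zero_add, ← hzc]
      simp [hη0]
    rw [walkDir, spinDir, this]
    cases W.fed c <;> cases e <;> rfl
  refine ⟨x, s, hx, hs, fun hreg => ?_, fun a d r hr hra => hfeed a d r hr hra⟩
  obtain ⟨b, hb, hpb⟩ : ∃ b ∈ Function.periodicPts (W.spin e x), p ∈ W.shadow e x b := by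
    simpa [region] using hreg
  obtain ⟨t, ht, hbt⟩ := W.exists_tip_eq e (x := x) b
  have hl := W.short (W.spin e x b)
  have hdet : det3 (tip e x b) (tip e x (W.spin e x b)) p =
      sin ((W.spin e x b).1.len - t) *
        (W.spin e x b).1.lside (spinDir e x (W.spin e x b)) p := by
    rw [← hbt, tip_eq, det3_along]
  -- A shadow lies weakly beyond the great circle of its arc as seen from `x`, and `p` is not
  -- strictly beyond any.
  have h0 : (W.spin e x b).1.side p = 0 := by
    by_contra h
    have h3 := hη _ h
    have h4 := spin_lside_pos e hx (W.spin e x b)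
    have h5 : 0 < sgn e * (W.spin e x b).1.lside (spinDir e x (W.spin e x b)) p := by
      have h6 : 0 < (sgn e * (W.spin e x b).1.lside (spinDir e x (W.spin e x b)) x) *
          (sgn e * (W.spin e x b).1.lside (spinDir e x (W.spin e x b)) p) := by
        refine h3.trans_eq ?_
        have : ∀ d, (W.spin e x b).1.lside d x * (W.spin e x b).1.lside d p =
            (W.spin e x b).1.side p * (W.spin e x b).1.side x := by
          intro d; cases d <;> simp [lside] <;> ring
        rw [← this (spinDir e x (W.spin e x b))]
        linear_combination (-(W.spin e x b).1.lside (spinDir e x (W.spin e x b)) x *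
          (W.spin e x b).1.lside (spinDir e x (W.spin e x b)) p) * sgn_mul_self e
      exact (mul_pos_iff_of_pos_left h4).1 h6
    have h7 := hpb.2.2
    rw [hdet, mul_left_comm] at h7
    have := mul_pos (sin_pos_of_pos_of_lt_pi (show 0 < (W.spin e x b).1.len - t by linarith [ht.2])
      (by linarith [ht.1])) h5
    linarith
  have h0' : det3 (tip e x b) (tip e x (W.spin e x b)) p = 0 := by
    rw [hdet]; cases spinDir e x (W.spin e x b) <;> simp [lside, h0]
  obtain ⟨b', hb', u, r, hu, hur, hr, htip, hpr⟩ :=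
    W.exists_along_of_mem_shadow e hx hb (norm_along _ _ _) hpb h0'
  have hbc : W.spin e x b' = c := by
    refine W.eq_of_mem (p := p) ?_ ?_
    · rw [relInterior_eq _ (spinDir e x (W.spin e x b'))]
      exact ⟨r, ⟨by linarith, hr⟩, hpr⟩
    · rw [relInterior_eq _ (W.walkDir e c)]
      exact ⟨s, hs, rfl⟩
  rw [hbc] at htip hpr hr
  have hrs : r = c.1.len - s := by
    rw [hdir, along_not] at hpr
    exact along_injOn _ _ ⟨by linarith, hr.le⟩ ⟨by linarith [hs.2], by linarith [hs.1]⟩ hpr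
  -- The cycle would enter `c` no earlier, in the order of the walk, than `p`, but all arrivals come
  -- before `s`.
  have := hfeed b' (spinDir e x b') (c.1.len - u) ⟨by linarith, by linarith⟩ (by
    rw [hdir, along_not, sub_sub_cancel, htip]; rfl)
  linarith

/-- For each arc, some cycle of the walk that always turns in the sense `e` avoids it. -/
lemma exists_periodic_avoiding (c : S) : ∃ a ∈ Function.periodicPts (W.walk e),
    ∀ n, (W.walk e)^[n] a ≠ c := by
  obtain ⟨x, s, hx, hs, hreg, hfeed⟩ := W.exists_observer e c
  let Inv : S → Prop := fun a => ∃ r ∈ Ioo 0 a.1.len,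
    a.1.along (W.walkDir e a) r ∈ W.region e x ∧
      ∃ (b : S) (d : Bool), a.1.along (W.walkDir e a) r = b.1.head d
  have harrive : ∀ (a : S) (d : Bool), a.1.head d ∈ W.region e x → Inv (W.tgt d a) := by
    intro a d h
    have hm := W.head_mem d a
    rw [relInterior_eq _ (W.walkDir e (W.tgt d a))] at hm
    obtain ⟨r, hr, hra⟩ := hm
    exact ⟨r, hr, by rwa [hra], a, d, hra⟩
  have hstep : ∀ a, Inv a → Inv (W.walk e a) := by
    rintro a ⟨r, hr, hra, -⟩
    refine harrive a (W.walkDir e a) ?_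
    rw [head_eq]
    exact W.along_mem_region e hx a hr hra _ ⟨hr.2.le, le_rfl⟩
  -- From any arrival on `c` inside the region the walk would carry the region along to the point at
  -- `s`.
  have hc : ¬ Inv c := by
    rintro ⟨r, hr, hra, b, d, hbd⟩
    exact hreg (W.along_mem_region e hx c hr hra s ⟨(hfeed b d r hr hbd).le, hs.2.le⟩)
  have hper : ∀ (f : S → S) (a : S), ∃ n, f^[n] a ∈ Function.periodicPts f := by
    intro f a
    obtain ⟨m, n, hmn, h⟩ := Finite.exists_ne_map_eq_of_infinite fun n : ℕ => f^[n] a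
    wlog hlt : m < n generalizing m n
    · exact this n m hmn.symm h.symm (lt_of_le_of_ne (not_lt.1 hlt) hmn.symm)
    refine ⟨m, Function.mk_mem_periodicPts (n := n - m) (by omega) ?_⟩
    rw [Function.IsPeriodicPt, Function.IsFixedPt, ← Function.iterate_add_apply,
      Nat.sub_add_cancel hlt.le]
    exact h.symm
  obtain ⟨k, hk⟩ := hper (W.spin e x) c
  -- The walk starts where a tip of a spin cycle arrives.
  have hstart : Inv (W.spin e x ((W.spin e x)^[k] c)) :=
    harrive _ _ (W.mem_region e hk (W.tip_mem_shadow e hx _))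
  have hiter : ∀ {a : S}, Inv a → ∀ n, Inv ((W.walk e)^[n] a) := by
    intro a ha n
    induction n with
    | zero => exact ha
    | succ n ih => rw [Function.iterate_succ_apply']; exact hstep _ ih
  obtain ⟨n, hn⟩ := hper (W.walk e) (W.spin e x ((W.spin e x)^[k] c))
  exact ⟨_, hn, fun m hm => hc (hm ▸ hiter (hiter hstart n) m)⟩

end Wiring

end SOD

/-! ### Cycles of a function -/

section Cycle

variable {α : Type*}

lemma Cycle.exists_eq_cons_of_mem {c : Cycle α} {a : α} (h : a ∈ c) :
    ∃ l : List α, c = ((a :: l : List α) : Cycle α) := by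
  induction c using Quotient.inductionOn' with
  | h m =>
    obtain ⟨s, t, rfl⟩ := List.append_of_mem (show a ∈ m from h)
    exact ⟨t ++ s, Cycle.coe_eq_coe.2
      (by simpa using! List.isRotated_append (l := s) (l' := a :: t))⟩

lemma Cycle.exists_mem_of_ne_nil {c : Cycle α} (h : c ≠ Cycle.nil) : ∃ a, a ∈ c := by
  induction c using Quotient.inductionOn' with
  | h m =>
    cases m with
    | nil => exact absurd rfl h
    | cons a l => exact ⟨a, Cycle.mem_coe_iff.2 List.mem_cons_self⟩

lemma Cycle.Chain.exists_pred {r : α → α → Prop} {c : Cycle α} (h : c.Chain r) {a : α}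
    (ha : a ∈ c) : ∃ b ∈ c, r b a := by
  obtain ⟨l, rfl⟩ := Cycle.exists_eq_cons_of_mem ha
  rw [Cycle.chain_ne_nil r (List.cons_ne_nil a l), List.isChain_cons_cons] at h
  exact ⟨_, Cycle.mem_coe_iff.2 (List.getLast_mem _), h.1⟩

lemma Cycle.Chain.exists_succ {r : α → α → Prop} {c : Cycle α} (h : c.Chain r) {a : α}
    (ha : a ∈ c) : ∃ b ∈ c, r a b := by
  obtain ⟨l, rfl⟩ := Cycle.exists_eq_cons_of_mem ha
  rw [Cycle.chain_coe_cons] at h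
  cases l with
  | nil => exact ⟨a, ha, by simpa using h⟩
  | cons b l => exact ⟨b, by simp, (List.isChain_cons_cons.1 h).1⟩

lemma Cycle.Chain.and {r r' : α → α → Prop} {c : Cycle α} (h : c.Chain r) (h' : c.Chain r') :
    c.Chain fun a b => r a b ∧ r' a b := by
  by_cases hc : c = Cycle.nil
  · subst hc; exact Cycle.Chain.nil _
  · induction c using Quotient.inductionOn' with
    | h m =>
      cases m with
      | nil => exact absurd rfl hc
      | cons a l =>
        have h1 := (Cycle.chain_coe_cons r a l).1 h
        have h2 := (Cycle.chain_coe_cons r' a l).1 h'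
        refine (Cycle.chain_coe_cons _ a l).2 ?_
        generalize a :: (l ++ [a]) = m at h1 h2
        induction m with
        | nil => exact List.isChain_nil
        | cons x m ih =>
          rw [List.isChain_cons] at h1 h2 ⊢
          exact ⟨fun y hy => ⟨h1.1 y hy, h2.1 y hy⟩, ih h1.2 h2.2⟩

lemma List.IsChain.prefix_of_function {f : α → α} {l l' : List α} {a : α}
    (h : (a :: l).IsChain fun x y => y = f x) (h' : (a :: l').IsChain fun x y => y = f x)
    (hl : l.length ≤ l'.length) : l <+: l' := by
  induction l generalizing a l' with
  | nil => exact List.nil_prefix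
  | cons b l ih =>
    cases l' with
    | nil => simp at hl
    | cons b' l' =>
      rw [List.isChain_cons_cons] at h h'
      obtain rfl : b = b' := h.1.trans h'.1.symm
      exact (List.prefix_cons_inj b).2 (ih h.2 h'.2 (by simpa using hl))

/-- Two cycles of a function without repetitions that share an element are equal. -/
lemma Cycle.eq_of_chain_function {f : α → α} {c c' : Cycle α} (hn : c.Nodup) (hn' : c'.Nodup)
    (h : c.Chain fun x y => y = f x) (h' : c'.Chain fun x y => y = f x) {a : α}
    (ha : a ∈ c) (ha' : a ∈ c') : c = c' := by
  obtain ⟨l, rfl⟩ := Cycle.exists_eq_cons_of_mem ha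
  obtain ⟨l', rfl⟩ := Cycle.exists_eq_cons_of_mem ha'
  rw [Cycle.chain_coe_cons] at h h'
  wlog hl : l.length ≤ l'.length generalizing l l'
  · exact (this l' hn' h' ha' l hn h ha (le_of_not_ge hl)).symm
  have hp := List.IsChain.prefix_of_function h h' (by simpa using hl)
  rcases hl.lt_or_eq with hl | hl
  · have h1 : l ++ [a] <+: l' := List.prefix_of_prefix_length_le hp (List.prefix_append _ _)
      (by simpa using hl)
    have h2 : a ∈ l' := h1.subset (by simp)
    rw [Cycle.nodup_coe_iff, List.nodup_cons] at hn'
    exact absurd h2 hn'.1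
  · have h1 := hp.eq_of_length (by simp [hl])
    rw [List.append_cancel_right h1]

end Cycle

/-! ### Swirls as cycles of the walks -/

namespace SOD

open GreatArc

/-- A turn to the right (`e = true`) or to the left (`e = false`). -/
def IsTurn (e : Bool) (d : GreatArc → Bool) (a b : GreatArc) : Prop :=
  a.head (d a) ∈ b.relInterior ∧ a.relInterior ⊆ b.leftOf (d b ^^ e)

lemma isTurn_true : IsTurn true = RightTurn := by
  funext d a b; simp [IsTurn, RightTurn, rightOf]

lemma isTurn_false : IsTurn false = LeftTurn := by
  funext d a b; simp [IsTurn, LeftTurn]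

/-- A swirl whose turns are all of the sense `e`. -/
def IsSwirlOf (S : Finset GreatArc) (e : Bool) (c : Cycle GreatArc) : Prop :=
  c ≠ Cycle.nil ∧ c.Nodup ∧ (∀ a ∈ c, a ∈ S) ∧ ∃ d : GreatArc → Bool, c.Chain (IsTurn e d)

lemma swirls_eq (S : Finset GreatArc) :
    swirls S = {c | IsSwirlOf S true c} ∪ {c | IsSwirlOf S false c} := by
  ext c
  change IsSwirl S c ↔ IsSwirlOf S true c ∨ IsSwirlOf S false c
  rw [IsSwirl, IsSwirlOf, IsSwirlOf, isTurn_true, isTurn_false]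
  simp only [exists_or]
  tauto

namespace Wiring

variable {S : Finset GreatArc} (W : Wiring S) (e : Bool)

open Classical in
/-- The walk that always turns in the sense `e`, as a total function. -/
def next (a : GreatArc) : GreatArc := if h : a ∈ S then W.walk e ⟨a, h⟩ else a

lemma next_coe (a : S) : W.next e a = W.walk e a := by simp [next]

variable {W e}

/-- Each arc of a swirl has a predecessor in it, which arrives from the fed side; the sense of the
turn then forces the direction of traversal, and the direction forces the next arc. -/
lemma chain_next {c : Cycle GreatArc} (h : IsSwirlOf S e c) :
    c.Chain fun a b => b = W.next e a := by
  obtain ⟨hne, -, hS, d, hd⟩ := h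
  have hdir : ∀ a : S, a.1 ∈ c → d a = W.walkDir e a := by
    intro a ha
    obtain ⟨b, hb, hba⟩ := hd.exists_pred ha
    obtain ⟨p, hp⟩ := b.relInterior_nonempty
    have h1 := W.subset_leftOf (a := ⟨b, hS b hb⟩) (b := a) ⟨_, hba.1⟩ hp
    have h2 := hba.2 hp
    rw [mem_leftOf] at h1 h2
    have h3 : (d a ^^ e) = W.fed a := by
      by_contra hcon
      have : (d a ^^ e) = !W.fed a := by
        revert hcon; cases (d a ^^ e) <;> cases W.fed a <;> simp
      rw [this, lside_not] at h2
      linarith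
    rw [walkDir, ← h3, Bool.xor_assoc, Bool.xor_self, Bool.xor_false]
  have hmem : c.Chain fun a b => a ∈ c ∧ b ∈ c := Cycle.chain_of_pairwise fun a ha b hb => ⟨ha, hb⟩
  refine (hd.and hmem).imp fun a b ⟨hab, ha, hb⟩ => ?_
  have h1 := W.head_mem (d a) ⟨a, hS a ha⟩
  have h2 := W.eq_of_mem (a := ⟨b, hS b hb⟩) hab.1 h1
  rw [W.next_coe e ⟨a, hS a ha⟩, walk, ← hdir ⟨a, hS a ha⟩ ha, ← h2]

lemma IsSwirlOf.walk_mem {c : Cycle GreatArc} (h : IsSwirlOf S e c) {a : S} (ha : a.1 ∈ c) (n : ℕ) :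
    ((W.walk e)^[n] a).1 ∈ c := by
  induction n with
  | zero => exact ha
  | succ n ih =>
    obtain ⟨b, hb, hab⟩ := (chain_next (W := W) h).exists_succ ih
    rw [Function.iterate_succ_apply', ← next_coe, ← hab]
    exact hb

lemma isSwirlOf_unique (W : Wiring S) {c c' : Cycle GreatArc} (h : IsSwirlOf S e c)
    (h' : IsSwirlOf S e c') {a : GreatArc} (ha : a ∈ c) (ha' : a ∈ c') : c = c' :=
  Cycle.eq_of_chain_function h.2.1 h'.2.1 (chain_next (W := W) h) (chain_next (W := W) h') ha ha'

/-- The two senses traverse an arc in opposite directions, and its two ends feed into different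
arcs. -/
lemma not_isSwirlOf_both (W : Wiring S) {c : Cycle GreatArc} (h : IsSwirlOf S true c) :
    ¬ IsSwirlOf S false c := by
  intro h'
  obtain ⟨a, ha⟩ := Cycle.exists_mem_of_ne_nil h.1
  obtain ⟨b, hb, h1, h2⟩ :=
    ((chain_next (W := W) h).and (chain_next (W := W) h')).exists_succ ha
  have h3 := h1.symm.trans h2
  have haS := h.2.2.1 a ha
  rw [W.next_coe _ ⟨a, haS⟩, W.next_coe _ ⟨a, haS⟩] at h3
  exact W.tgt_ne ⟨a, haS⟩ (by simp [walkDir]) (Subtype.ext h3)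

variable (W)

/-- The swirl of the arcs in a cycle of the walk. -/
def orbit (e : Bool) (a : S) : Cycle GreatArc :=
  (Function.periodicOrbit (W.walk e) a).map Subtype.val

lemma mem_orbit {a b : S} (ha : a ∈ Function.periodicPts (W.walk e)) :
    b.1 ∈ W.orbit e a ↔ ∃ n, (W.walk e)^[n] a = b := by
  simp [orbit, Cycle.mem_map, Function.mem_periodicOrbit_iff ha]

lemma isSwirlOf_orbit {a : S} (ha : a ∈ Function.periodicPts (W.walk e)) :
    IsSwirlOf S e (W.orbit e a) := by
  classical
  refine ⟨?_, ?_, ?_, ?_⟩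
  · rw [orbit, Ne, Cycle.map_eq_nil, Function.periodicOrbit_eq_nil_iff_not_periodic_pt]
    exact not_not.2 ha
  · have := Function.nodup_periodicOrbit (f := W.walk e) (x := a)
    rw [orbit]
    rw [Function.periodicOrbit] at this ⊢
    rw [Cycle.map_coe, Cycle.nodup_coe_iff]
    exact (Cycle.nodup_coe_iff.1 this).map Subtype.val_injective
  · intro b hb
    obtain ⟨b', -, rfl⟩ := Cycle.mem_map.1 hb
    exact b'.2
  · refine ⟨fun b => if h : b ∈ S then W.walkDir e ⟨b, h⟩ else true, ?_⟩
    rw [orbit, Cycle.chain_map, Function.periodicOrbit_chain' _ ha]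
    intro n
    rw [Function.iterate_succ_apply']
    set b := (W.walk e)^[n] a
    have h1 := W.head_mem (W.walkDir e b) b
    refine ⟨by simpa using! h1, ?_⟩
    have h2 := W.subset_leftOf (a := b) (b := W.walk e b) ⟨_, h1⟩
    simpa [walkDir, Bool.xor_assoc] using h2

/-- The avoidance lemma is used twice; the orbit of `b` avoids `a`, so it differs from that of `a`.
-/
lemma two_le_encard_isSwirlOf (W : Wiring S) (hS : S.Nonempty) (e : Bool) :
    2 ≤ {c | IsSwirlOf S e c}.encard := by
  obtain ⟨c, hc⟩ := hS
  obtain ⟨a, ha, -⟩ := W.exists_periodic_avoiding e ⟨c, hc⟩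
  obtain ⟨b, hb, hab⟩ := W.exists_periodic_avoiding e a
  have hne : W.orbit e a ≠ W.orbit e b := by
    intro h
    have h1 : a.1 ∈ W.orbit e a := (W.mem_orbit ha).2 ⟨0, rfl⟩
    rw [h, W.mem_orbit hb] at h1
    obtain ⟨n, hn⟩ := h1
    exact hab n hn
  rw [← Set.encard_pair hne]
  refine Set.encard_le_encard ?_
  rintro _ (rfl | rfl)
  · exact W.isSwirlOf_orbit ha
  · exact W.isSwirlOf_orbit hb

/-- If the walk always gets to one of two arcs, there are at most two swirls of its sense. -/
lemma encard_isSwirlOf_le_two {r r' : S}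
    (h : ∀ a : S, ∃ n, (W.walk e)^[n] a = r ∨ (W.walk e)^[n] a = r') :
    {c | IsSwirlOf S e c}.encard ≤ 2 := by
  have hone : ∀ a : S, {c | IsSwirlOf S e c ∧ a.1 ∈ c}.encard ≤ 1 := fun a =>
    Set.encard_le_one_iff.2 fun c c' hc hc' => W.isSwirlOf_unique hc.1 hc'.1 hc.2 hc'.2
  refine (Set.encard_le_encard (t := {c | IsSwirlOf S e c ∧ r.1 ∈ c} ∪
    {c | IsSwirlOf S e c ∧ r'.1 ∈ c}) fun c (hc : IsSwirlOf S e c) => ?_).trans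
      ((Set.encard_union_le _ _).trans ((add_le_add (hone r) (hone r')).trans_eq one_add_one_eq_two))
  obtain ⟨a, ha⟩ := Cycle.exists_mem_of_ne_nil hc.1
  obtain ⟨n, hn⟩ := h ⟨a, hc.2.2.1 a ha⟩
  have hm := IsSwirlOf.walk_mem (W := W) hc (a := ⟨a, hc.2.2.1 a ha⟩) ha n
  rcases hn with hn | hn
  · exact Or.inl ⟨hc, hn ▸ hm⟩
  · exact Or.inr ⟨hc, hn ▸ hm⟩

end Wiring

theorem IsSOD.four_le_encard_swirls {S : Finset GreatArc} (hS : IsSOD S) :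
    4 ≤ (swirls S).encard := by
  obtain ⟨W⟩ := hS.nonempty_wiring
  have hdisj : Disjoint {c | IsSwirlOf S true c} {c | IsSwirlOf S false c} :=
    Set.disjoint_left.2 fun c hc hc' => W.not_isSwirlOf_both hc hc'
  rw [swirls_eq, Set.encard_union_eq hdisj]
  calc (4 : ℕ∞) = 2 + 2 := by norm_num
    _ ≤ _ := add_le_add (W.two_le_encard_isSwirlOf hS.nonempty true)
      (W.two_le_encard_isSwirlOf hS.nonempty false)

/-! ### Arcs given by their endpoints -/

namespace GreatArc

/-- Two vectors that are not parallel are, up to positive factors, the endpoints of an arc that is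
shorter than a semicircle. -/
lemma exists_of_inner_sq_lt {u v : E3} (h : inner ℝ u v ^ 2 < inner ℝ u u * inner ℝ v v) :
    ∃ a : GreatArc, a.len < π ∧ a.head false = ‖u‖⁻¹ • u ∧ a.head true = ‖v‖⁻¹ • v := by
  have hu0 : u ≠ 0 := by rintro rfl; simp at h
  have hv0 : v ≠ 0 := by rintro rfl; simp at h
  have hu : 0 < ‖u‖ := norm_pos_iff.2 hu0
  have hv : 0 < ‖v‖ := norm_pos_iff.2 hv0
  set p := ‖u‖⁻¹ • u with hp
  set q := ‖v‖⁻¹ • v with hq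
  set c := inner ℝ p q with hc
  have hpp : inner ℝ p p = (1 : ℝ) := by
    rw [real_inner_self_eq_norm_sq, hp, norm_smul, norm_inv, norm_norm, inv_mul_cancel₀ hu.ne']
    norm_num
  have hqq : inner ℝ q q = (1 : ℝ) := by
    rw [real_inner_self_eq_norm_sq, hq, norm_smul, norm_inv, norm_norm, inv_mul_cancel₀ hv.ne']
    norm_num
  have hcs : c ^ 2 < 1 := by
    rw [real_inner_self_eq_norm_sq, real_inner_self_eq_norm_sq] at h
    have : c = inner ℝ u v / (‖u‖ * ‖v‖) := by
      rw [hc, hp, hq, inner_smul_left, inner_smul_right]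
      simp; field_simp
    rw [this, div_pow, div_lt_one (by positivity)]
    nlinarith
  have hc1 : -1 < c := by nlinarith
  have hc2 : c < 1 := by nlinarith
  have hs : 0 < √(1 - c ^ 2) := Real.sqrt_pos.2 (by linarith)
  have hs2 : √(1 - c ^ 2) ^ 2 = 1 - c ^ 2 := Real.sq_sqrt (by linarith)
  set s := √(1 - c ^ 2) with hsdef
  have hqp : inner ℝ q p = c := by rw [hc, real_inner_comm]
  clear_value p q
  -- Gram-Schmidt, with `c` and `s` the cosine and sine of the angle between `p` and `q`.
  refine ⟨⟨p, s⁻¹ • (q - c • p), arccos c, ?_, ?_, ?_, ?_, ?_⟩, ?_, ?_, ?_⟩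
  · rw [real_inner_self_eq_norm_sq] at hpp
    nlinarith [norm_nonneg p]
  · have h1 : ‖q - c • p‖ ^ 2 = s ^ 2 := by
      rw [← real_inner_self_eq_norm_sq, hs2]
      simp only [inner_sub_left, inner_sub_right, inner_smul_left, inner_smul_right, hpp, hqq,
        hqp, ← hc]
      simp; ring
    have h2 : ‖q - c • p‖ = s := by
      rwa [sq_eq_sq₀ (norm_nonneg _) hs.le] at h1
    rw [norm_smul, h2, norm_inv, Real.norm_of_nonneg hs.le, inv_mul_cancel₀ hs.ne']
  · rw [inner_smul_right, inner_sub_right, inner_smul_right, hpp, ← hc]; ring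
  · exact arccos_pos.2 hc2
  · have := arccos_le_pi c; have := pi_pos; linarith
  · change arccos c < π
    refine (arccos_le_pi c).lt_of_ne fun h => ?_
    have := cos_arccos hc1.le hc2.le
    rw [h, cos_pi] at this
    linarith
  · simp [head, point]
  · simp only [head, point, if_true]
    rw [cos_arccos hc1.le hc2.le, sin_arccos, ← hsdef, smul_smul, mul_inv_cancel₀ hs.ne', one_smul]
    abel

variable {a : GreatArc} {u v : E3}

/-- The relative interior of an arc in terms of the cone of its endpoints. -/
lemma mem_relInterior_iff {k l : ℝ} (ha : a.len < π) (hk : 0 < k) (hl : 0 < l)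
    (hu : a.head false = k • u) (hv : a.head true = l • v) {p : E3} :
    p ∈ a.relInterior ↔ ‖p‖ = 1 ∧ ∃ β γ : ℝ, 0 < β ∧ 0 < γ ∧ p = β • u + γ • v := by
  have h0 : a.along true 0 = k • u := by rw [← hu]; simp [along, head]
  have h1 : a.along true a.len = l • v := by rw [← hv, head_eq]
  have h0' : a.along false a.len = k • u := by rw [← hu, head_eq]
  have h1' : a.along false 0 = l • v := by rw [← hv]; simp [along, head]
  have hpos := a.len_pos
  constructor
  · rw [relInterior_eq a true]
    rintro ⟨t, ⟨ht0, ht1⟩, rfl⟩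
    have hs : 0 < sin a.len := sin_pos_of_pos_of_lt_pi hpos ha
    have hs1 : 0 < sin (a.len - t) := sin_pos_of_pos_of_lt_pi (by linarith) (by linarith)
    have hs2 : 0 < sin t := sin_pos_of_pos_of_lt_pi ht0 (by linarith)
    refine ⟨norm_along _ _ _, sin (a.len - t) / sin a.len * k, sin t / sin a.len * l,
      by positivity, by positivity, ?_⟩
    rw [mul_smul, mul_smul, ← h0, ← h1]
    have h3 : sin a.len • a.along true t =
        sin (a.len - t) • a.along true 0 + sin t • a.along true a.len := by
      have hsc := sin_sq_add_cos_sq t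
      simp only [along, point, if_true, cos_zero, sin_zero, sin_sub]
      module
    have h4 := congrArg (fun x => (sin a.len)⁻¹ • x) h3
    simpa only [smul_smul, smul_add, inv_mul_cancel₀ hs.ne', one_smul, inv_mul_eq_div] using h4
  · rintro ⟨hp, β, γ, hβ, hγ, hpe⟩
    have hu' : u = k⁻¹ • a.along true 0 := by rw [h0, smul_smul, inv_mul_cancel₀ hk.ne', one_smul]
    have hv' : v = l⁻¹ • a.along true a.len := by
      rw [h1, smul_smul, inv_mul_cancel₀ hl.ne', one_smul]
    rw [hu', hv', smul_smul, smul_smul] at hpe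
    -- The cone lemma excludes only the final endpoint; applying it in both directions excludes
    -- both.
    obtain ⟨r, hr, hpr⟩ := a.exists_along_eq true hpos (by linarith)
      (mul_pos hβ (inv_pos.2 hk)) (mul_pos hγ (inv_pos.2 hl)).le hp hpe
    obtain ⟨r', hr', hpr'⟩ := a.exists_along_eq false hpos (by linarith)
      (mul_pos hγ (inv_pos.2 hl)) (mul_pos hβ (inv_pos.2 hk)).le hp (by
        rw [h1', h0', ← h1, ← h0, add_comm, ← hpe])
    have h2 : r = a.len - r' := by
      refine a.along_injOn true ⟨hr.1, hr.2.le⟩ ⟨by linarith [hr'.2], by linarith [hr'.1]⟩ ?_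
      rw [← hpr, ← along_not]; exact hpr'
    rw [relInterior_eq a true]
    exact ⟨r, ⟨by linarith [hr'.2], hr.2⟩, hpr.symm⟩

/-- The side of a vector in terms of the endpoints of an arc. -/
lemma exists_side_eq {k l : ℝ} (ha : a.len < π) (hk : 0 < k) (hl : 0 < l)
    (hu : a.head false = k • u) (hv : a.head true = l • v) :
    ∃ c : ℝ, 0 < c ∧ ∀ x, a.side x = c * det3 u v x := by
  have hs : 0 < sin a.len := sin_pos_of_pos_of_lt_pi a.len_pos ha
  refine ⟨k * l / sin a.len, by positivity, fun x => ?_⟩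
  have h := a.det3_point 0 a.len x
  have h0 : a.point 0 = k • u := by rw [← hu]; simp [head]
  have h1 : a.point a.len = l • v := by rw [← hv]; simp [head]
  have h2 : det3 (k • u) (l • v) x = k * l * det3 u v x := by
    simp only [det3_apply, PiLp.smul_apply, smul_eq_mul]; ring
  rw [h0, h1, sub_zero, h2] at h
  field_simp
  linarith

end GreatArc

/-! ### A diagram with eight arcs and four swirls -/

section IntegerVectors

/-- A vector with integer coordinates. -/
def ofInt (z : Fin 3 → ℤ) : E3 := !₂[(z 0 : ℝ), (z 1 : ℝ), (z 2 : ℝ)]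

/-- The dot product of integer vectors, in a form that computes. -/
def dotInt (x y : Fin 3 → ℤ) : ℤ := x 0 * y 0 + x 1 * y 1 + x 2 * y 2

/-- The cross product of integer vectors, in a form that computes. -/
def crossInt (x y : Fin 3 → ℤ) : Fin 3 → ℤ :=
  ![x 1 * y 2 - x 2 * y 1, x 2 * y 0 - x 0 * y 2, x 0 * y 1 - x 1 * y 0]

lemma inner_ofInt (x y : Fin 3 → ℤ) : inner ℝ (ofInt x) (ofInt y) = (dotInt x y : ℝ) := by
  rw [PiLp.inner_apply, Fin.sum_univ_three]
  simp [ofInt, dotInt]; ring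

lemma det3_ofInt (x y z : Fin 3 → ℤ) :
    det3 (ofInt x) (ofInt y) (ofInt z) = (dotInt (crossInt x y) z : ℝ) := by
  rw [det3_apply]
  simp [ofInt, dotInt, crossInt]; ring

end IntegerVectors

namespace EightArcs

/-- The directions of the endpoints of the arcs of an occlusion diagram with eight arcs. -/
def pt : Bool → Fin 8 → Fin 3 → ℤ
  -- The rotary reflection `(x, y, z) ↦ (-y, x, -z)` permutes the arcs cyclically in two orbits, 0
  -- to 3 and 4 to 7. It reverses orientation, hence the alternating values of `fedSide`.
  | false => ![![28, -4, -25], ![4, 28, 25], ![-28, 4, -25], ![-4, -28, 25],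
      ![-11, 20, 4], ![-20, -11, -4], ![11, -20, 4], ![20, 11, -4]]
  | true => ![![-4, 19, 22], ![-19, -4, -22], ![4, -19, 22], ![19, 4, -22],
      ![5, -12, 4], ![12, 5, -4], ![-5, 12, 4], ![-12, -5, -4]]

/-- The arc that an end of an arc feeds into. -/
def tg : Bool → Fin 8 → Fin 8
  | false => ![3, 0, 1, 2, 1, 2, 3, 0]
  | true => ![6, 7, 4, 5, 3, 0, 1, 2]

/-- The side from which an arc is fed. -/
def fedSide : Fin 8 → Bool := ![false, true, false, true, false, true, false, true]

/-- A multiple of the side of an integer vector with respect to an arc. -/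
def sideInt (i : Fin 8) (z : Fin 3 → ℤ) : ℤ := dotInt (crossInt (pt false i) (pt true i)) z

/-- The first coefficient of a vector in the plane of `x` and `y`, up to the Gram determinant. -/
def coeffInt (x y z : Fin 3 → ℤ) : ℤ := dotInt z x * dotInt y y - dotInt z y * dotInt x y

/-- The Gram determinant of two integer vectors. -/
def gramInt (x y : Fin 3 → ℤ) : ℤ := dotInt x x * dotInt y y - dotInt x y ^ 2

/-- The arc `i` is weakly on the positive side and the arc `j` weakly on the negative side of the
plane normal to `m`, and not both are in that plane. -/
def Separates (m : Fin 3 → ℤ) (i j : Fin 8) : Prop :=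
  (0 ≤ dotInt m (pt false i) ∧ 0 ≤ dotInt m (pt true i) ∧
    dotInt m (pt false j) ≤ 0 ∧ dotInt m (pt true j) ≤ 0) ∧
  0 < dotInt m (pt false i) + dotInt m (pt true i) - dotInt m (pt false j) - dotInt m (pt true j)

instance (m : Fin 3 → ℤ) (i j : Fin 8) : Decidable (Separates m i j) := by
  unfold Separates; infer_instance

lemma gram_pos : ∀ i, 0 < gramInt (pt false i) (pt true i) := by decide +kernel

lemma pt_mem_cone : ∀ d i,
    0 < coeffInt (pt false (tg d i)) (pt true (tg d i)) (pt d i) ∧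
    0 < coeffInt (pt true (tg d i)) (pt false (tg d i)) (pt d i) ∧
    ∀ k, gramInt (pt false (tg d i)) (pt true (tg d i)) * pt d i k =
      coeffInt (pt false (tg d i)) (pt true (tg d i)) (pt d i) * pt false (tg d i) k +
      coeffInt (pt true (tg d i)) (pt false (tg d i)) (pt d i) * pt true (tg d i) k := by
  decide +kernel

/-- The candidate planes are spanned by two of the four endpoints, up to orientation, which makes
the search for a separating plane finite. -/
lemma exists_separates : ∀ i j, i ≠ j →
    ∃ p ∈ [(false, i, true, i), (false, j, true, j), (false, i, false, j), (false, i, true, j),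
      (true, i, false, j), (true, i, true, j)],
      Separates (crossInt (pt p.1 p.2.1) (pt p.2.2.1 p.2.2.2)) i j ∨
      Separates (crossInt (pt p.2.2.1 p.2.2.2) (pt p.1 p.2.1)) i j := by
  decide +kernel

lemma side_pt : ∀ d i, sideInt (tg d i) (pt d i) = 0 ∧
    0 < bif fedSide (tg d i) then sideInt (tg d i) (pt (!d) i)
      else -sideInt (tg d i) (pt (!d) i) := by
  decide +kernel

lemma tg_ne : ∀ i, tg true i ≠ tg false i := by decide

lemma exists_tg_eq : ∀ j, ∃ d i, tg d i = j := by decide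

/-- The next arc of the walk that always turns in the sense `e`. -/
def nextIdx (e : Bool) (i : Fin 8) : Fin 8 := tg (fedSide i ^^ e) i

/-- The cycles are 0, 6, 1 and 2, 4, 3 for right turns, and 0, 3, 5 and 1, 7, 2 for left turns; the
other two arcs lead into them. -/
lemma exists_iterate_nextIdx : ∀ e i, ∃ n : Fin 8,
    (nextIdx e)^[n] i = 0 ∨ (nextIdx e)^[n] i = bif e then 2 else 1 := by
  decide +kernel

/-- A family of arcs with endpoints in the prescribed directions. -/
def IsModel (A : Fin 8 → GreatArc) : Prop := ∀ i, (A i).len < π ∧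
  ∀ d, ∃ k : ℝ, 0 < k ∧ (A i).head d = k • ofInt (pt d i)

lemma exists_isModel : ∃ A, IsModel A := by
  suffices H : ∀ i, ∃ a : GreatArc, a.len < π ∧
      ∀ d, ∃ k : ℝ, 0 < k ∧ a.head d = k • ofInt (pt d i) from Classical.skolem.1 H
  intro i
  have h := gram_pos i
  obtain ⟨a, ha, h0, h1⟩ := exists_of_inner_sq_lt (u := ofInt (pt false i)) (v := ofInt (pt true i))
    (by
      rw [inner_ofInt, inner_ofInt, inner_ofInt]
      have := sub_pos.1 h
      exact_mod_cast this)
  have hne : ∀ d, 0 < ‖ofInt (pt d i)‖⁻¹ := by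
    intro d
    refine inv_pos.2 (norm_pos_iff.2 fun h0 => ?_)
    have h1 := inner_ofInt (pt false i) (pt true i)
    have h2 := inner_ofInt (pt d i) (pt d i)
    rw [gramInt] at h
    cases d
    · rw [h0, inner_zero_left] at h1 h2
      have h1' : dotInt (pt false i) (pt true i) = 0 := by exact_mod_cast h1.symm
      have h2' : dotInt (pt false i) (pt false i) = 0 := by exact_mod_cast h2.symm
      rw [h1', h2'] at h; simp at h
    · rw [h0, inner_zero_right] at h1 h2
      have h1' : dotInt (pt false i) (pt true i) = 0 := by exact_mod_cast h1.symm
      have h2' : dotInt (pt true i) (pt true i) = 0 := by exact_mod_cast h2.symm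
      rw [h1', h2'] at h; simp at h
  refine ⟨a, ha, fun d => ⟨_, hne d, ?_⟩⟩
  cases d
  · exact h0
  · exact h1

namespace IsModel

variable {A : Fin 8 → GreatArc}

lemma mem_relInterior (hA : IsModel A) (i : Fin 8) {p : E3} : p ∈ (A i).relInterior ↔ ‖p‖ = 1 ∧
    ∃ β γ : ℝ, 0 < β ∧ 0 < γ ∧ p = β • ofInt (pt false i) + γ • ofInt (pt true i) := by
  obtain ⟨k, hk, hk'⟩ := (hA i).2 false
  obtain ⟨l, hl, hl'⟩ := (hA i).2 true
  exact mem_relInterior_iff (hA i).1 hk hl hk' hl'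

lemma head_mem (hA : IsModel A) (d : Bool) (i : Fin 8) :
    (A i).head d ∈ (A (tg d i)).relInterior := by
  obtain ⟨k, hk, hk'⟩ := (hA i).2 d
  obtain ⟨h1, h2, h3⟩ := pt_mem_cone d i
  have h0 : (0 : ℝ) < gramInt (pt false (tg d i)) (pt true (tg d i)) := by
    exact_mod_cast gram_pos (tg d i)
  set D := gramInt (pt false (tg d i)) (pt true (tg d i))
  set B := coeffInt (pt false (tg d i)) (pt true (tg d i)) (pt d i)
  set C := coeffInt (pt true (tg d i)) (pt false (tg d i)) (pt d i)
  have h1' : (0 : ℝ) < B := by exact_mod_cast h1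
  have h2' : (0 : ℝ) < C := by exact_mod_cast h2
  refine (hA.mem_relInterior _).2 ⟨by rw [head_eq, norm_along],
    k * (B / D), k * (C / D), by positivity, by positivity, ?_⟩
  rw [hk', mul_smul, mul_smul, ← smul_add]
  congr 1
  have h4 : ∀ m, (D : ℝ) * (pt d i m : ℝ) =
      B * (pt false (tg d i) m : ℝ) + C * (pt true (tg d i) m : ℝ) := fun m => by
    exact_mod_cast h3 m
  ext m
  fin_cases m
  · have := h4 0; simp [ofInt]; field_simp; linarith
  · have := h4 1; simp [ofInt]; field_simp; linarith
  · have := h4 2; simp [ofInt]; field_simp; linarith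

/-- Pairing a common point with the normal of a separating plane gives a value of both weak signs;
all four endpoints would then be in the plane. -/
lemma disjoint (hA : IsModel A) {i j : Fin 8} (hij : i ≠ j) :
    Disjoint (A i).relInterior (A j).relInterior := by
  obtain ⟨m, ⟨h1, h2, h3, h4⟩, h5⟩ : ∃ m, Separates m i j := by
    obtain ⟨p, -, h | h⟩ := exists_separates i j hij
    · exact ⟨_, h⟩
    · exact ⟨_, h⟩
  refine Set.disjoint_left.2 fun p hp hp' => ?_
  obtain ⟨-, β, γ, hβ, hγ, rfl⟩ := (hA.mem_relInterior i).1 hp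
  obtain ⟨-, β', γ', hβ', hγ', h⟩ := (hA.mem_relInterior j).1 hp'
  have h6 := congrArg (fun x => inner ℝ (ofInt m) x) h
  simp only [inner_add_right, inner_smul_right, inner_ofInt] at h6
  have h1' : (0 : ℝ) ≤ dotInt m (pt false i) := by exact_mod_cast h1
  have h2' : (0 : ℝ) ≤ dotInt m (pt true i) := by exact_mod_cast h2
  have h3' : (dotInt m (pt false j) : ℝ) ≤ 0 := by exact_mod_cast h3
  have h4' : (dotInt m (pt true j) : ℝ) ≤ 0 := by exact_mod_cast h4
  have h5' : (0 : ℝ) < dotInt m (pt false i) + dotInt m (pt true i) - dotInt m (pt false j)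
      - dotInt m (pt true j) := by exact_mod_cast h5
  have e1 := mul_nonneg hβ.le h1'
  have e2 := mul_nonneg hγ.le h2'
  have e3 := mul_nonpos_of_nonneg_of_nonpos hβ'.le h3'
  have e4 := mul_nonpos_of_nonneg_of_nonpos hγ'.le h4'
  have f1 := (mul_eq_zero.1 (show β * (dotInt m (pt false i) : ℝ) = 0 by linarith)).resolve_left
    hβ.ne'
  have f2 := (mul_eq_zero.1 (show γ * (dotInt m (pt true i) : ℝ) = 0 by linarith)).resolve_left
    hγ.ne'
  have f3 := (mul_eq_zero.1 (show β' * (dotInt m (pt false j) : ℝ) = 0 by linarith)).resolve_left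
    hβ'.ne'
  have f4 := (mul_eq_zero.1 (show γ' * (dotInt m (pt true j) : ℝ) = 0 by linarith)).resolve_left
    hγ'.ne'
  linarith

lemma injective (hA : IsModel A) : Function.Injective A := by
  intro i j h
  by_contra hij
  have := hA.disjoint hij
  rw [h, disjoint_self] at this
  exact (A j).relInterior_nonempty.ne_empty this

lemma eq_of_mem (hA : IsModel A) {i j : Fin 8} {p : E3} (hi : p ∈ (A i).relInterior)
    (hj : p ∈ (A j).relInterior) : i = j := by
  by_contra hij
  exact Set.disjoint_left.1 (hA.disjoint hij) hi hj

lemma subset_leftOf (hA : IsModel A) (d : Bool) (i : Fin 8) :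
    (A i).relInterior ⊆ (A (tg d i)).leftOf (fedSide (tg d i)) := by
  intro p hp
  obtain ⟨-, β, γ, hβ, hγ, rfl⟩ := (hA.mem_relInterior i).1 hp
  obtain ⟨k, hk, hk'⟩ := (hA (tg d i)).2 false
  obtain ⟨l, hl, hl'⟩ := (hA (tg d i)).2 true
  obtain ⟨c, hc, hside⟩ := exists_side_eq (hA (tg d i)).1 hk hl hk' hl'
  obtain ⟨h0, h1⟩ := side_pt d i
  rw [mem_leftOf, lside, hside, det3_add, det3_smul, det3_smul, det3_ofInt, det3_ofInt]
  change 0 < if fedSide (tg d i) = true then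
    c * (β * (sideInt (tg d i) (pt false i) : ℝ) + γ * (sideInt (tg d i) (pt true i) : ℝ)) else
    -(c * (β * (sideInt (tg d i) (pt false i) : ℝ) + γ * (sideInt (tg d i) (pt true i) : ℝ)))
  generalize fedSide (tg d i) = f at h1
  have key : ∀ (x y : ℤ) (b : ℝ), 0 < b → (0 < bif f then x else -x) →
      0 < if f = true then c * (b * x) else -(c * (b * x)) := by
    intro x y b hb hx
    cases f
    · have : (0 : ℝ) < -(x : ℝ) := by exact_mod_cast hx
      have := mul_pos hc (mul_pos hb this)
      simp; linarith
    · have : (0 : ℝ) < (x : ℝ) := by exact_mod_cast hx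
      simpa using mul_pos hc (mul_pos hb this)
  cases d
  · rw [h0]
    simpa using key _ 0 γ hγ h1
  · rw [h0]
    simpa using key _ 0 β hβ h1

lemma exists_of_feedsInto (hA : IsModel A) {i j : Fin 8} (h : FeedsInto (A i) (A j)) :
    ∃ d, tg d i = j := by
  obtain ⟨d, hd⟩ := h
  exact ⟨d, hA.eq_of_mem (hA.head_mem d i) hd⟩

end IsModel

open Classical in
/-- The arcs of a model as a finite set. -/
def arcs (A : Fin 8 → GreatArc) : Finset GreatArc := Finset.univ.image A

lemma mem_arcs {A : Fin 8 → GreatArc} {a : GreatArc} : a ∈ arcs A ↔ ∃ i, A i = a := by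
  simp [arcs]

lemma IsModel.isSOD {A : Fin 8 → GreatArc} (hA : IsModel A) : IsSOD (arcs A) where
  nonempty := ⟨A 0, mem_arcs.2 ⟨0, rfl⟩⟩
  short a ha := by
    obtain ⟨i, rfl⟩ := mem_arcs.1 ha
    exact (hA i).1
  disjoint a ha b hb hab := by
    obtain ⟨i, rfl⟩ := mem_arcs.1 ha
    obtain ⟨j, rfl⟩ := mem_arcs.1 hb
    exact hA.disjoint fun h => hab (congrArg A h)
  feeds_two a ha := by
    obtain ⟨i, rfl⟩ := mem_arcs.1 ha
    rw [show {b | b ∈ arcs A ∧ FeedsInto (A i) b} = {A (tg true i), A (tg false i)} from ?_]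
    · exact Set.encard_pair fun h => tg_ne i (hA.injective h)
    · ext b
      constructor
      · rintro ⟨hb, h⟩
        obtain ⟨j, rfl⟩ := mem_arcs.1 hb
        obtain ⟨d, rfl⟩ := hA.exists_of_feedsInto h
        cases d
        · exact Or.inr rfl
        · exact Or.inl rfl
      · rintro (rfl | rfl)
        · exact ⟨mem_arcs.2 ⟨_, rfl⟩, true, hA.head_mem true i⟩
        · exact ⟨mem_arcs.2 ⟨_, rfl⟩, false, hA.head_mem false i⟩
  same_side b hb := by
    obtain ⟨j, rfl⟩ := mem_arcs.1 hb
    refine ⟨fedSide j, fun a ha h => ?_⟩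
    obtain ⟨i, rfl⟩ := mem_arcs.1 ha
    obtain ⟨d, rfl⟩ := hA.exists_of_feedsInto h
    exact hA.subset_leftOf d i

lemma IsModel.encard_swirls_le {A : Fin 8 → GreatArc} (hA : IsModel A) :
    (swirls (arcs A)).encard ≤ 4 := by
  obtain ⟨W⟩ := hA.isSOD.nonempty_wiring
  let B : Fin 8 → arcs A := fun i => ⟨A i, mem_arcs.2 ⟨i, rfl⟩⟩
  have htgt : ∀ d i, W.tgt d (B i) = B (tg d i) := fun d i =>
    W.eq_of_mem (W.head_mem d (B i)) (hA.head_mem d i)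
  -- Every arc is fed by some arc, which determines the side in any wiring.
  have hfed : ∀ j, W.fed (B j) = fedSide j := by
    intro j
    obtain ⟨d, i, rfl⟩ := exists_tg_eq j
    obtain ⟨p, hp⟩ := (A i).relInterior_nonempty
    have h1 := W.subset_leftOf (a := B i) (b := B (tg d i)) ⟨d, hA.head_mem d i⟩ hp
    have h2 := hA.subset_leftOf d i hp
    rw [mem_leftOf] at h1 h2
    by_contra hcon
    have h3 : W.fed (B (tg d i)) = !fedSide (tg d i) := by
      revert hcon; cases W.fed (B (tg d i)) <;> cases fedSide (tg d i) <;> simp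
    rw [h3, lside_not] at h1
    change 0 < -(A (tg d i)).lside _ p at h1
    linarith
  have hwalk : ∀ e i, W.walk e (B i) = B (nextIdx e i) := fun e i => by
    rw [Wiring.walk, Wiring.walkDir, hfed, htgt, nextIdx]
  have hiter : ∀ e i n, (W.walk e)^[n] (B i) = B ((nextIdx e)^[n] i) := by
    intro e i n
    induction n with
    | zero => rfl
    | succ n ih => rw [Function.iterate_succ_apply', Function.iterate_succ_apply', ih, hwalk]
  have htwo : ∀ e, {c | IsSwirlOf (arcs A) e c}.encard ≤ 2 := by
    intro e
    refine W.encard_isSwirlOf_le_two (r := B 0) (r' := B (bif e then 2 else 1)) fun a => ?_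
    obtain ⟨i, hi⟩ := mem_arcs.1 a.2
    obtain rfl : B i = a := Subtype.ext hi
    obtain ⟨n, hn⟩ := exists_iterate_nextIdx e i
    exact ⟨n, hn.imp (fun h => by rw [hiter, h]) (fun h => by rw [hiter, h])⟩
  rw [swirls_eq]
  refine (Set.encard_union_le _ _).trans ((add_le_add (htwo true) (htwo false)).trans_eq ?_)
  norm_num

end EightArcs

end SOD

end

/-- Every spherical occlusion diagram has at least four swirls, and some have exactly four. -/
theorem theorem7 :
    (∀ S : Finset SOD.GreatArc, SOD.IsSOD S → 4 ≤ (SOD.swirls S).encard) ∧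
      ∃ S : Finset SOD.GreatArc, SOD.IsSOD S ∧ (SOD.swirls S).encard = 4 := by
  refine ⟨fun S hS => hS.four_le_encard_swirls, ?_⟩
  obtain ⟨A, hA⟩ := SOD.EightArcs.exists_isModel
  exact ⟨_, hA.isSOD, le_antisymm hA.encard_swirls_le hA.isSOD.four_le_encard_swirls⟩
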